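/- Graphs are finite and connected; self-edges and parallel edges are allowed. The degree $\deg(v)$ of a vertex $v$ is the number of edges incident to $v$ (a self-edge counts once). Simple random walk moves at each step along an edge chosen uniformly among the edges incident to its current position. A sequence of graphs $G_n$ with $|V(G_n)|\to\infty$ is called Gino-regular if there is a sequence of real numbers $D_n$ such that, as $n\to\infty$, (i) the maximum and the minimum degree of a vertex of $G_n$ are $(1+o(1))D_n$; and (ii) the maximum and the minimum, over distinct vertices $x,y,z$ of $G_n$, of the probability that simple random walk on $G_n$ started at $x$ hits $y$ before $z$ are $1/2+o(1)$. For a finite tree $t$ rooted at $x$ and a tree $W$ rooted at $v$, let $N(W;t)$ be the number of tree-maps from $t$ into $W$, that is, of injective maps from the vertices of $t$ to the vertices of $W$ that map $x$ to $v$ and neighbors to neighbors. Let $|t|$ be the number of vertices of $t$. Let $(G_n)$ be a Gino-regular sequence of graphs, let $v_n$ be a vertex of $G_n$, and let $\mathbf T_n$ be a spanning tree of $G_n$ chosen uniformly at random among all spanning trees of $G_n$, rooted at $v_n$. Then for every finite rooted tree $t$, $$\mathbf E\, N(\mathbf T_n;t)\longrightarrow |t|\qquad\text{as } n\to\infty .$$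 -/

import Mathlib

open Filter Topology

/-- A graph with vertex set `V` and edge set `E`; self-edges and parallel edges are allowed.
`ends e` is the unordered pair of (possibly equal) end vertices of the edge `e`. -/
structure MGraph (V E : Type*) where
  ends : E → Sym2 V

namespace MGraph

noncomputable section

variable {V E : Type*}

/-- The neighbour relation of the subgraph of `G` with vertex set `V` and edge set `S`:
distinct vertices `a`, `b` are adjacent iff some edge in `S` connects them. -/
def nbrGraph (G : MGraph V E) (S : Set E) : SimpleGraph V :=
  SimpleGraph.fromEdgeSet (G.ends '' S)

/-- Any two vertices are joined by a path of edges (and there is a vertex). -/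
def Connected (G : MGraph V E) : Prop :=
  (G.nbrGraph Set.univ).Connected

/-- The subgraph with edge set `S` is connected and has no cycles: no cycle of length one
(self-edge), none of length two (pair of parallel edges), and no longer one. -/
def IsSpanningTree (G : MGraph V E) (S : Finset E) : Prop :=
  (∀ e ∈ S, ¬ (G.ends e).IsDiag) ∧ Set.InjOn G.ends (S : Set E) ∧
    (G.nbrGraph (S : Set E)).IsTree

open Classical in
/-- The finite set of all spanning trees of `G`. -/
def spanningTrees [Fintype E] (G : MGraph V E) : Finset (Finset E) :=
  {S | G.IsSpanningTree S}

open Classical in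
/-- The probability that a uniform spanning tree of `G` equals `S`. -/
def ustProb [Fintype E] (G : MGraph V E) (S : Finset E) : ℝ :=
  if S ∈ G.spanningTrees then 1 / (G.spanningTrees.card : ℝ) else 0

/-- The expectation of `X T`, for `T` a uniform spanning tree of `G`. -/
def ustExpectation [Fintype E] (G : MGraph V E) (X : Finset E → ℝ) : ℝ :=
  ∑ S : Finset E, G.ustProb S * X S

open Classical in
/-- The number of edges incident to `v` (a self-edge counts once). -/
def degree [Fintype E] (G : MGraph V E) (v : V) : ℕ :=
  Finset.card {e : E | v ∈ G.ends e}

open Classical in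
/-- One-step transition probability of simple random walk from `x` to `y`: one of the edges
incident to `x` is chosen uniformly and the walk moves along it. -/
def stepProb [Fintype E] (G : MGraph V E) (x y : V) : ℝ :=
  (Finset.card {e : E | G.ends e = s(x, y)} : ℝ) / (G.degree x : ℝ)

/-- The probability that simple random walk started at `γ 0` has
`γ 0, γ 1, …, γ k` as its first `k + 1` positions. -/
def pathProb [Fintype E] (G : MGraph V E) {k : ℕ} (γ : Fin (k + 1) → V) : ℝ :=
  ∏ i : Fin k, G.stepProb (γ i.castSucc) (γ i.succ)

open Classical in
/-- For `y ≠ z`, the probability that simple random walk started at `x` visits `y` and does so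
before visiting `z`: the sum over all times `k` of the probability that the walk is
in `{y, z}` at time `k` for the first time, and is then at `y`. -/
def hitBeforeProb [Fintype V] [Fintype E] (G : MGraph V E) (x y z : V) : ℝ :=
  ∑' k : ℕ, ∑ γ : Fin (k + 1) → V with
    (γ 0 = x ∧ γ (Fin.last k) = y ∧ ∀ i : Fin k, γ i.castSucc ≠ y ∧ γ i.castSucc ≠ z),
    G.pathProb γ

/-- A sequence of graphs whose number of vertices tends to infinity is Gino-regular if, for some
sequence `D`, all degrees are `(1 + o(1)) D n` and all probabilities that the
walk from `x` hits `y` before `z`, for `x, y, z` distinct, are `1/2 + o(1)`, uniformly over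
the vertices. -/
def GinoRegular {V E : ℕ → Type*} [∀ n, Fintype (V n)] [∀ n, Fintype (E n)]
    (G : ∀ n, MGraph (V n) (E n)) : Prop :=
  Tendsto (fun n => Fintype.card (V n)) atTop atTop ∧
  ∃ D : ℕ → ℝ,
    (∀ ε > 0, ∀ᶠ n in atTop, ∀ v : V n, |((G n).degree v : ℝ) - D n| ≤ ε * D n) ∧
    (∀ ε > 0, ∀ᶠ n in atTop, ∀ x y z : V n, x ≠ y → x ≠ z → y ≠ z →
      |(G n).hitBeforeProb x y z - 1 / 2| ≤ ε)

end

end MGraph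

/-- `N(W; t)`: the number of injective maps from the vertices of `t` to the vertices of `W` that
send the root `x` to the root `v` and neighbours to neighbours. -/
noncomputable def treeMapCount {τ V : Type*} (t : SimpleGraph τ) (x : τ)
    (W : SimpleGraph V) (v : V) : ℕ :=
  Nat.card {f : τ → V // Function.Injective f ∧ f x = v ∧
    ∀ a b, t.Adj a b → W.Adj (f a) (f b)}

/-!
Exploring `t` from its root `x` gives a list of `k = |t| - 1` pairs `(parent, child)`. For an
injective map `f` of the vertices of `t`, contracting the edges of the copy of `t` shows that the
number of pairs (spanning tree, realization of the copy by its edges) is the product of the edge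
multiplicities with the number of spanning forests rooted at the image of `f`. By the matrix-tree
theorem and Jacobi's identity that number of forests is the number of spanning trees times a minor
of the Green function killed at `f x`, whose entries factor as (hitting probability) · (effective
resistance). Hence `E N(T; t)` is the sum over `f` of `∏ w (f p) (f y)` times a correlation factor,
where `w a b` is the expected number of edges between `a` and `b` in a uniform spanning tree, and
the correlation factor consists of a product of `k` ratios of effective resistances and of a
`k × k` determinant of hitting probabilities.

For `z ≠ a`, decomposing the walk from `z` according to the edge by which it first reaches `a`
gives `∑ b, w a b * P_z(hit b before a) = 1`. The probability is `1` for `b = z` and close to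
`1 / 2` otherwise, and averaging over `z` shows that the weights `w a b` at `a` are uniformly
small with sum close to `2`; so the products of weights sum to about `2 ^ k`. By
reversibility the ratios of resistances tend to `1`. The determinant tends to that of the matrix
with entries `1` on the diagonal and `1 / 2` off it, which is `(k + 1) / 2 ^ k`.
-/

namespace MGraph

section RootedForests

variable {V E : Type*} {G : MGraph V E} {S : Finset V} {B : Finset E} {e : E} {s y : V}

/-- Every vertex is joined to a vertex of `S` by edges in `B`. -/
def Covers (G : MGraph V E) (S : Finset V) (B : Finset E) : Prop :=
  ∀ z, ∃ s ∈ S, (G.nbrGraph (B : Set E)).Reachable z s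

/-- `B` is the edge set of a spanning forest of which every component contains exactly one
vertex of `S`. The forest condition is encoded by counting: no smaller set of edges covers. -/
def IsRootedForest [Fintype V] (G : MGraph V E) (S : Finset V) (B : Finset E) : Prop :=
  G.Covers S B ∧ B.card + S.card = Fintype.card V

theorem nbrGraph_adj {A : Set E} {a b : V} :
    (G.nbrGraph A).Adj a b ↔ (∃ e ∈ A, G.ends e = s(a, b)) ∧ a ≠ b := by
  simp [nbrGraph]

theorem edgeSet_nbrGraph (G : MGraph V E) (A : Set E) :
    (G.nbrGraph A).edgeSet = G.ends '' A \ {q | q.IsDiag} :=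
  SimpleGraph.edgeSet_fromEdgeSet _

theorem nbrGraph_mono (G : MGraph V E) {A A' : Set E} (h : A ⊆ A') :
    G.nbrGraph A ≤ G.nbrGraph A' :=
  SimpleGraph.fromEdgeSet_mono (Set.image_mono h)

theorem Covers.exists_crossing (h : G.Covers S B) {z : V} (hz : z ∉ S) :
    ∃ e ∈ B, ∃ s ∈ S, ∃ y ∉ S, G.ends e = s(s, y) := by
  obtain ⟨s, hs, ⟨p⟩⟩ := h z
  obtain ⟨d, -, hfst, hsnd⟩ := p.exists_boundary_dart {a | a ∉ S} hz (by simpa using hs)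
  obtain ⟨⟨e, he, hends⟩, -⟩ := nbrGraph_adj.1 d.adj
  exact ⟨e, he, d.snd, by simpa using hsnd, d.fst, hfst, by rw [hends, Sym2.eq_swap]⟩

theorem Covers.insert_erase [DecidableEq V] [DecidableEq E] (h : G.Covers S B)
    (he : G.ends e = s(s, y)) (hs : s ∈ S) : G.Covers (insert y S) (B.erase e) := by
  intro z
  obtain ⟨w, hw, ⟨p⟩⟩ := h z
  induction p with
  | nil => exact ⟨_, Finset.mem_insert_of_mem hw, .refl _⟩
  | @cons a b c hab _ ih =>
    obtain ⟨⟨e', he', hends⟩, hne⟩ := nbrGraph_adj.1 hab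
    by_cases hee : e' = e
    · have ha : a ∈ s(s, y) := by
        rw [← he, ← hee, hends]
        exact Sym2.mem_mk_left a b
      refine ⟨a, ?_, .refl _⟩
      rcases Sym2.mem_iff.1 ha with rfl | rfl
      · exact Finset.mem_insert_of_mem hs
      · exact Finset.mem_insert_self _ _
    · obtain ⟨s', hs', hr⟩ := ih hw
      have hadj : (G.nbrGraph (B.erase e : Finset E)).Adj a b :=
        nbrGraph_adj.2 ⟨⟨e', Finset.mem_coe.2 (Finset.mem_erase.2 ⟨hee, he'⟩), hends⟩, hne⟩
      exact ⟨s', hs', hadj.reachable.trans hr⟩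

theorem Covers.of_insert [DecidableEq V] [DecidableEq E] (h : G.Covers (insert y S) B)
    (he : G.ends e = s(s, y)) (hs : s ∈ S) : G.Covers S (insert e B) := by
  intro z
  obtain ⟨w, hw, hr⟩ := h z
  have hzw := hr.mono (G.nbrGraph_mono (Finset.coe_subset.2 (Finset.subset_insert e B)))
  rcases Finset.mem_insert.1 hw with rfl | hw
  · by_cases hws : w = s
    · exact ⟨w, hws ▸ hs, hzw⟩
    · have hadj : (G.nbrGraph (insert e B : Finset E)).Adj w s :=
        nbrGraph_adj.2 ⟨⟨e, by simp, by rw [he, Sym2.eq_swap]⟩, hws⟩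
      exact ⟨s, hs, hzw.trans hadj.reachable⟩
  · exact ⟨w, hw, hzw⟩

theorem Connected.covers [Fintype E] (hG : G.Connected) (hs : s ∈ S) :
    G.Covers S Finset.univ := fun z =>
  ⟨s, hs, by simpa using hG.preconnected z s⟩

section Fintype

variable [Fintype V]

theorem Covers.induction_on [DecidableEq V] [DecidableEq E]
    {motive : Finset V → Finset E → Prop} (h : G.Covers S B)
    (univ : ∀ B, motive Finset.univ B)
    (crossing : ∀ {S B e s y}, e ∈ B → s ∈ S → y ∉ S → G.ends e = s(s, y) →
      motive (insert y S) (B.erase e) → motive S B) :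
    motive S B := by
  induction B using Finset.strongInduction generalizing S with
  | H B ih =>
    by_cases hS : ∃ z, z ∉ S
    · obtain ⟨z, hz⟩ := hS
      obtain ⟨e, he, s, hs, y, hy, hends⟩ := h.exists_crossing hz
      exact crossing he hs hy hends
        (ih _ (Finset.erase_ssubset he) (h.insert_erase hends hs))
    · rw [Finset.eq_univ_iff_forall.2 (not_exists_not.1 hS)]
      exact univ B

theorem Covers.card_le (h : G.Covers S B) : Fintype.card V ≤ B.card + S.card := by
  classical
  refine h.induction_on (motive := fun S B => Fintype.card V ≤ B.card + S.card)
    (fun B => by simp) fun {S B e s y} he _ hy _ ih => ?_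
  rw [Finset.card_insert_of_notMem hy] at ih
  have := Finset.card_erase_add_one he
  lia

theorem IsRootedForest.ends_ne (h : G.IsRootedForest S B) (he : e ∈ B) {a b : V} (ha : a ∈ S)
    (hb : b ∈ S) : G.ends e ≠ s(a, b) := by
  classical
  intro hends
  have hle := (h.1.insert_erase hends ha).card_le
  rw [Finset.insert_eq_of_mem hb] at hle
  have := Finset.card_erase_add_one he
  have := h.2
  lia

theorem isRootedForest_insert_iff [DecidableEq V] [DecidableEq E] (he : G.ends e = s(s, y))
    (hs : s ∈ S) (hy : y ∉ S) (heB : e ∉ B) :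
    G.IsRootedForest S (insert e B) ↔ G.IsRootedForest (insert y S) B := by
  have hcover : G.Covers S (insert e B) ↔ G.Covers (insert y S) B :=
    ⟨fun h => Finset.erase_insert heB ▸ h.insert_erase he hs, fun h => h.of_insert he hs⟩
  rw [IsRootedForest, IsRootedForest, hcover, Finset.card_insert_of_notMem hy,
    Finset.card_insert_of_notMem heB, add_right_comm, add_assoc]

theorem isRootedForest_univ_iff : G.IsRootedForest Finset.univ B ↔ B = ∅ :=
  ⟨fun h => by simpa [Finset.card_univ] using h.2,
    fun h => ⟨fun z => ⟨z, Finset.mem_univ z, .refl _⟩, by simp [h, Finset.card_univ]⟩⟩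

theorem Covers.exists_isRootedForest (h : G.Covers S B) :
    ∃ F ⊆ B, G.IsRootedForest S F := by
  classical
  refine h.induction_on (motive := fun S B => ∃ F ⊆ B, G.IsRootedForest S F)
    (fun B => ⟨∅, Finset.empty_subset B, isRootedForest_univ_iff.2 rfl⟩) ?_
  rintro S B e s y he hs hy hends ⟨F, hFB, hF⟩
  rw [Finset.subset_erase] at hFB
  exact ⟨insert e F, Finset.insert_subset he hFB.1,
    (isRootedForest_insert_iff hends hs hy hFB.2).2 hF⟩

end Fintype

theorem IsSpanningTree.isRootedForest [Fintype V] (h : G.IsSpanningTree B) (v : V) :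
    G.IsRootedForest {v} B := by
  classical
  obtain ⟨hdiag, hinj, htree⟩ := h
  refine ⟨fun z => ⟨v, Finset.mem_singleton_self v, htree.connected z v⟩, ?_⟩
  have hedges : B.image G.ends = (G.nbrGraph (B : Set E)).edgeFinset := by
    ext q
    rw [SimpleGraph.mem_edgeFinset, edgeSet_nbrGraph, Finset.mem_image]
    exact ⟨fun ⟨e, he, hq⟩ => ⟨⟨e, he, hq⟩, fun hd => hdiag e he (hq ▸ hd)⟩, And.left⟩
  rw [Finset.card_singleton, ← htree.card_edgeFinset, ← hedges, Finset.card_image_of_injOn hinj]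

theorem IsRootedForest.isSpanningTree [Fintype V] {v : V} (h : G.IsRootedForest {v} B) :
    G.IsSpanningTree B := by
  classical
  obtain ⟨hcover, hcard⟩ := h
  have hconn : (G.nbrGraph (B : Set E)).Connected := by
    have hreach : ∀ a, (G.nbrGraph (B : Set E)).Reachable a v := fun a => by
      simpa using hcover a
    exact { preconnected := fun a b => (hreach a).trans (hreach b).symm, nonempty := ⟨v⟩ }
  have hle := hconn.card_vert_le_card_edgeSet_add_one
  rw [Nat.card_eq_fintype_card, Nat.card_eq_fintype_card, ← SimpleGraph.edgeFinset_card] at hle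
  have hsub : (G.nbrGraph (B : Set E)).edgeFinset ⊆ B.image G.ends := by
    intro q hq
    rw [SimpleGraph.mem_edgeFinset, edgeSet_nbrGraph] at hq
    exact Finset.mem_image.2 hq.1
  have hcard_sub := Finset.card_le_card hsub
  have hcard_image : (B.image G.ends).card ≤ B.card := Finset.card_image_le
  rw [Finset.card_singleton] at hcard
  have hedges : (G.nbrGraph (B : Set E)).edgeFinset = B.image G.ends :=
    Finset.eq_of_subset_of_card_le hsub (by lia)
  refine ⟨fun e he hd => ?_, Finset.card_image_iff.1 (by lia), ?_⟩
  · exact SimpleGraph.not_isDiag_of_mem_edgeFinset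
      (hedges ▸ Finset.mem_image_of_mem G.ends he) hd
  · rw [SimpleGraph.isTree_iff_connected_and_card, Nat.card_eq_fintype_card,
      Nat.card_eq_fintype_card, ← SimpleGraph.edgeFinset_card]
    exact ⟨hconn, by lia⟩

theorem isSpanningTree_iff_isRootedForest [Fintype V] (v : V) :
    G.IsSpanningTree B ↔ G.IsRootedForest {v} B :=
  ⟨fun h => h.isRootedForest v, IsRootedForest.isSpanningTree⟩

end RootedForests

section ForestCount

variable {V E : Type*} [Fintype V] {G : MGraph V E} {A : Finset E} {S : Finset V}

open Classical in
/-- The number of spanning forests with edges in `A` of which every component contains exactly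
one vertex of `S`. -/
noncomputable def forestCount (G : MGraph V E) (A : Finset E) (S : Finset V) : ℕ :=
  (A.powerset.filter (G.IsRootedForest S)).card

theorem forestCount_univ : G.forestCount A Finset.univ = 1 := by
  classical
  simp only [forestCount, isRootedForest_univ_iff, Finset.card_eq_one]
  exact ⟨∅, by ext B; simp +contextual⟩

theorem forestCount_eq_zero {z : V} (hz : z ∉ S)
    (hA : ∀ e ∈ A, ∀ s ∈ S, ∀ y ∉ S, G.ends e ≠ s(s, y)) : G.forestCount A S = 0 := by
  classical
  rw [forestCount, Finset.card_eq_zero, Finset.filter_eq_empty_iff]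
  intro B hB hforest
  obtain ⟨e, he, s, hs, y, hy, hends⟩ := hforest.1.exists_crossing hz
  exact hA e (Finset.mem_powerset.1 hB he) s hs y hy hends

theorem forestCount_eq_add [DecidableEq V] [DecidableEq E] {e : E} (he : e ∈ A) {s y : V}
    (hends : G.ends e = s(s, y)) (hs : s ∈ S) (hy : y ∉ S) :
    G.forestCount A S =
      G.forestCount (A.erase e) S + G.forestCount (A.erase e) (insert y S) := by
  classical
  simp only [forestCount, Finset.card_filter]
  conv_lhs => rw [← Finset.insert_erase he]
  rw [Finset.sum_powerset_insert (Finset.notMem_erase e A)]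
  congr 1
  refine Finset.sum_congr rfl fun B hB => ?_
  have heB : e ∉ B := (Finset.subset_erase.1 (Finset.mem_powerset.1 hB)).2
  simp only [isRootedForest_insert_iff hends hs hy heB]

theorem Connected.forestCount_pos [Fintype E] (hG : G.Connected) (hS : S.Nonempty) :
    0 < G.forestCount Finset.univ S := by
  obtain ⟨s, hs⟩ := hS
  obtain ⟨B, -, hB⟩ := (hG.covers hs).exists_isRootedForest
  exact Finset.card_pos.2 ⟨B, by simpa using hB⟩

theorem forestCount_singleton [Fintype E] (v : V) :
    G.forestCount Finset.univ {v} = G.spanningTrees.card := by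
  refine congrArg Finset.card (Finset.ext fun B => ?_)
  simp [spanningTrees, isSpanningTree_iff_isRootedForest v]

end ForestCount

end MGraph

section Grows

variable {τ : Type*} [Fintype τ] [DecidableEq τ]

/-- `Grows U L`: starting from the vertex set `U`, the pairs `(old vertex, new vertex)` in the
list `L` enlarge `U` one vertex at a time until it contains all vertices. This records the order
in which a forest rooted at `U` is explored from its roots. -/
inductive Grows : Finset τ → List (τ × τ) → Prop
  | nil : Grows Finset.univ []
  | cons {U : Finset τ} {p y : τ} {L : List (τ × τ)} (hp : p ∈ U) (hy : y ∉ U)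
      (h : Grows (insert y U) L) : Grows U ((p, y) :: L)

namespace Grows

variable {U : Finset τ} {L : List (τ × τ)}

theorem length_add_card (h : Grows U L) : L.length + U.card = Fintype.card τ := by
  induction h with
  | nil => simp [Finset.card_univ]
  | cons _ hy _ ih =>
    rw [Finset.card_insert_of_notMem hy] at ih
    rw [List.length_cons]
    lia

theorem snd_notMem (h : Grows U L) : ∀ q ∈ L, q.2 ∉ U := by
  induction h with
  | nil => simp
  | cons _ hy _ ih =>
    refine List.forall_mem_cons.2 ⟨hy, fun q hq hU => ih q hq (Finset.mem_insert_of_mem hU)⟩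

theorem prod_map_snd {M : Type*} [CommMonoid M] (h : Grows U L) (F : τ → M) :
    (L.map fun q => F q.2).prod = ∏ y ∈ Uᶜ, F y := by
  induction h with
  | nil => simp
  | @cons U p y L _ hy _ ih =>
    rw [List.map_cons, List.prod_cons, ih, Finset.compl_insert,
      Finset.mul_prod_erase _ F (Finset.mem_compl.2 hy)]

end Grows

theorem MGraph.IsRootedForest.exists_grows {E : Type*} {G : MGraph τ E} {S : Finset τ}
    {B : Finset E} (h : G.IsRootedForest S B) :
    ∃ L, Grows S L ∧ B.image G.ends = (L.map fun q => s(q.1, q.2)).toFinset := by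
  classical
  have hcover := h.1
  revert h
  refine hcover.induction_on (motive := fun S B => G.IsRootedForest S B →
    ∃ L, Grows S L ∧ B.image G.ends = (L.map fun q => s(q.1, q.2)).toFinset) ?_ ?_
  · intro B h
    exact ⟨[], .nil, by simp [MGraph.isRootedForest_univ_iff.1 h]⟩
  · intro S B e s y he hs hy hends ih h
    rw [← Finset.insert_erase he, MGraph.isRootedForest_insert_iff hends hs hy (by simp)] at h
    obtain ⟨L, hL, hB⟩ := ih h
    refine ⟨(s, y) :: L, .cons hs hy hL, ?_⟩
    rw [← Finset.insert_erase he, Finset.image_insert, hB, hends, List.map_cons,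
      List.toFinset_cons]

theorem exists_grows_of_isTree {t : SimpleGraph τ} (ht : t.IsTree) (x : τ) :
    ∃ L, Grows {x} L ∧ ∀ a b, t.Adj a b ↔ s(a, b) ∈ L.map fun q => s(q.1, q.2) := by
  classical
  let G : MGraph τ (Sym2 τ) := ⟨id⟩
  have hG : G.nbrGraph (t.edgeFinset : Set (Sym2 τ)) = t := by
    simp [G, MGraph.nbrGraph]
  have htree : G.IsSpanningTree t.edgeFinset :=
    ⟨fun e he => SimpleGraph.not_isDiag_of_mem_edgeFinset he, Function.injective_id.injOn,
      hG.symm ▸ ht⟩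
  obtain ⟨L, hL, hedges⟩ := (htree.isRootedForest x).exists_grows
  refine ⟨L, hL, fun a b => ?_⟩
  rw [← List.mem_toFinset, ← hedges]
  simp [G]

end Grows

namespace MGraph

section ForestsThrough

variable {V E : Type*}

open Classical in
/-- The number of edges in `A` with ends `x` and `y`. -/
noncomputable def edgeCount (G : MGraph V E) (A : Finset E) (x y : V) : ℕ :=
  (A.filter fun e => G.ends e = s(x, y)).card

variable [Fintype V] [Fintype E] {G : MGraph V E} {S : Finset V} {p y : V} {L : List (V × V)}

open Classical in
/-- The rooted forests of `G` at `S` that connect each of the pairs in `L` by an edge. -/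
noncomputable def forestsThrough (G : MGraph V E) (S : Finset V) (L : List (V × V)) :
    Finset (Finset E) :=
  {B | G.IsRootedForest S B ∧ ∀ q ∈ L, ∃ e ∈ B, G.ends e = s(q.1, q.2)}

theorem mem_forestsThrough {B : Finset E} : B ∈ G.forestsThrough S L ↔
    G.IsRootedForest S B ∧ ∀ q ∈ L, ∃ e ∈ B, G.ends e = s(q.1, q.2) := by
  simp [forestsThrough]

theorem card_forestsThrough_nil :
    (G.forestsThrough S []).card = G.forestCount Finset.univ S :=
  congrArg Finset.card (Finset.ext fun B => by simp [mem_forestsThrough])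

theorem insert_mem_forestsThrough_cons_iff [DecidableEq V] [DecidableEq E] {e : E}
    {B : Finset E} (he : G.ends e = s(p, y)) (heB : e ∉ B) (hp : p ∈ S) (hy : y ∉ S)
    (hL : ∀ q ∈ L, q.2 ∉ insert y S) :
    insert e B ∈ G.forestsThrough S ((p, y) :: L) ↔ B ∈ G.forestsThrough (insert y S) L := by
  have hne : ∀ q ∈ L, G.ends e ≠ s(q.1, q.2) := by
    intro q hq h
    have hmem : q.2 ∈ s(p, y) := by
      rw [← he, h]
      exact Sym2.mem_mk_right q.1 q.2
    rcases Sym2.mem_iff.1 hmem with h | h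
    · exact hL q hq (h ▸ Finset.mem_insert_of_mem hp)
    · exact hL q hq (h ▸ Finset.mem_insert_self y S)
  simp only [mem_forestsThrough, isRootedForest_insert_iff he hp hy heB, List.forall_mem_cons,
    Finset.exists_mem_insert, he, true_or, true_and]
  refine and_congr_right fun _ => forall₂_congr fun q hq => ?_
  rw [← he, or_iff_right (hne q hq)]

theorem card_forestsThrough_cons [DecidableEq V] (hp : p ∈ S) (hy : y ∉ S)
    (hL : ∀ q ∈ L, q.2 ∉ insert y S) :
    (G.forestsThrough S ((p, y) :: L)).card =
      G.edgeCount Finset.univ p y * (G.forestsThrough (insert y S) L).card := by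
  classical
  have hnotMem : ∀ {e B}, G.ends e = s(p, y) → B ∈ G.forestsThrough (insert y S) L → e ∉ B :=
    fun he hB heB => (mem_forestsThrough.1 hB).1.ends_ne heB (Finset.mem_insert_of_mem hp)
      (Finset.mem_insert_self y S) he
  rw [edgeCount, ← Finset.card_product]
  symm
  refine Finset.card_bij (fun q _ => insert q.1 q.2) ?_ ?_ ?_
  · rintro ⟨e, B⟩ h
    obtain ⟨he, hB⟩ : G.ends e = s(p, y) ∧ B ∈ G.forestsThrough (insert y S) L := by
      simpa using h
    exact (insert_mem_forestsThrough_cons_iff he (hnotMem he hB) hp hy hL).2 hB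
  · rintro ⟨e, B⟩ h ⟨e', B'⟩ h' (heq : insert e B = insert e' B')
    obtain ⟨he, hB⟩ : G.ends e = s(p, y) ∧ B ∈ G.forestsThrough (insert y S) L := by
      simpa using h
    obtain ⟨he', hB'⟩ : G.ends e' = s(p, y) ∧ B' ∈ G.forestsThrough (insert y S) L := by
      simpa using h'
    obtain rfl : e = e' := by
      have hmem : e ∈ insert e' B' := heq ▸ Finset.mem_insert_self e B
      exact (Finset.mem_insert.1 hmem).resolve_right (hnotMem he hB')
    rw [← Finset.erase_insert (hnotMem he hB), heq, Finset.erase_insert (hnotMem he hB')]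
  · intro B hB
    obtain ⟨e, he, hends⟩ := (mem_forestsThrough.1 hB).2 _ List.mem_cons_self
    rw [← Finset.insert_erase he, insert_mem_forestsThrough_cons_iff hends
      (Finset.notMem_erase e B) hp hy hL] at hB
    exact ⟨(e, B.erase e), by simpa [hends] using hB, Finset.insert_erase he⟩

theorem card_forestsThrough_map [DecidableEq V] {τ : Type*} [Fintype τ] [DecidableEq τ]
    {f : τ → V} (hf : Function.Injective f) {U : Finset τ} {L : List (τ × τ)} (h : Grows U L) :
    (G.forestsThrough (U.image f) (L.map (Prod.map f f))).card =
      (L.map fun q => G.edgeCount Finset.univ (f q.1) (f q.2)).prod *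
        G.forestCount Finset.univ (Finset.univ.image f) := by
  induction h with
  | nil => simp [card_forestsThrough_nil]
  | @cons U p y L hp hy h ih =>
    have hL : ∀ q ∈ L.map (Prod.map f f), q.2 ∉ insert (f y) (U.image f) := by
      intro q hq
      obtain ⟨r, hr, rfl⟩ := List.mem_map.1 hq
      rw [← Finset.image_insert, Prod.map_snd, hf.mem_finset_image]
      exact h.snd_notMem r hr
    rw [List.map_cons, Prod.map_apply, card_forestsThrough_cons (Finset.mem_image_of_mem f hp)
      (by rwa [hf.mem_finset_image]) hL, ← Finset.image_insert, ih, List.map_cons,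
      List.prod_cons, mul_assoc]

end ForestsThrough

end MGraph

section UnitRows

variable {V : Type*} [DecidableEq V] {R : Type*} [CommRing R]

/-- The matrix `M` with the rows in `S` replaced by those of the unit matrix. -/
def unitRows (M : Matrix V V R) (S : Finset V) : Matrix V V R :=
  Matrix.of fun x => if x ∈ S then Pi.single x 1 else M x

theorem unitRows_of_mem (M : Matrix V V R) {S : Finset V} {x : V} (hx : x ∈ S) :
    unitRows M S x = Pi.single x 1 :=
  if_pos hx

theorem unitRows_of_notMem (M : Matrix V V R) {S : Finset V} {x : V} (hx : x ∉ S) :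
    unitRows M S x = M x :=
  if_neg hx

theorem unitRows_insert (M : Matrix V V R) (S : Finset V) (y : V) :
    unitRows M (insert y S) = (unitRows M S).updateRow y (Pi.single y 1) := by
  ext x w
  rcases eq_or_ne x y with rfl | hx
  · simp [unitRows]
  · simp [unitRows, hx]

theorem unitRows_unitRows (M : Matrix V V R) (S T : Finset V) :
    unitRows (unitRows M S) T = unitRows M (S ∪ T) := by
  ext x w
  by_cases hS : x ∈ S <;> by_cases hT : x ∈ T <;> simp [unitRows, hS, hT]

variable [Fintype V]

theorem unitRows_univ (M : Matrix V V R) : unitRows M Finset.univ = 1 := by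
  ext x w
  simp [unitRows, Matrix.one_apply, Pi.single_apply, eq_comm]

theorem det_unitRows_compl_image (M : Matrix V V R) {ι : Type*} [Fintype ι] [DecidableEq ι]
    {g : ι → V} (hg : Function.Injective g) :
    (unitRows M (Finset.univ.image g)ᶜ).det = (M.submatrix g g).det := by
  rw [Matrix.twoBlockTriangular_det _ (· ∈ Finset.univ.image g)]
  · have hunit : (unitRows M (Finset.univ.image g)ᶜ).toSquareBlockProp
        (¬ · ∈ Finset.univ.image g) = 1 := by
      ext ⟨z, hz⟩ w
      rw [Matrix.toSquareBlockProp_def, Matrix.of_apply,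
        unitRows_of_mem M (Finset.mem_compl.2 hz), Matrix.one_apply, Pi.single_apply]
      exact if_congr (eq_comm.trans (Subtype.ext_iff (a1 := ⟨z, hz⟩)).symm) rfl rfl
    let e : ι ≃ {z // z ∈ Finset.univ.image g} :=
      (Equiv.ofInjective g hg).trans (Equiv.subtypeEquivRight fun z => by simp)
    have hblock : ((unitRows M (Finset.univ.image g)ᶜ).toSquareBlockProp
        (· ∈ Finset.univ.image g)).submatrix e e = M.submatrix g g := by
      ext a b
      have hga : g a ∉ (Finset.univ.image g)ᶜ := by simp
      exact congrFun (unitRows_of_notMem M hga) (g b)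
    rw [hunit, Matrix.det_one, mul_one, ← hblock]
    convert (Matrix.det_submatrix_equiv_self e _).symm
  · intro z hz w hw
    rw [unitRows_of_mem M (Finset.mem_compl.2 hz)]
    exact Pi.single_eq_of_ne (ne_of_mem_of_not_mem hw hz) 1

theorem unitRows_eq_mul {M : Matrix V V R} (hM : IsUnit M.det) (S : Finset V) :
    unitRows M S = unitRows M⁻¹ Sᶜ * M := by
  funext x
  rw [Matrix.mul_apply_eq_vecMul]
  by_cases hx : x ∈ S
  · rw [unitRows_of_mem M hx, unitRows_of_notMem M⁻¹ (by simpa using hx),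
      ← Matrix.mul_apply_eq_vecMul, Matrix.nonsing_inv_mul M hM]
    ext w
    rw [Matrix.one_eq_pi_single]
  · rw [unitRows_of_notMem M hx, unitRows_of_mem M⁻¹ (by simpa using hx),
      Matrix.single_one_vecMul]
    rfl

/-- A form of Jacobi's identity for complementary minors of a matrix and its inverse. -/
theorem det_unitRows_image {M : Matrix V V R} (hM : IsUnit M.det) {ι : Type*} [Fintype ι]
    [DecidableEq ι] {g : ι → V} (hg : Function.Injective g) :
    (unitRows M (Finset.univ.image g)).det = M.det * (M⁻¹.submatrix g g).det := by
  rw [unitRows_eq_mul hM, Matrix.det_mul, det_unitRows_compl_image M⁻¹ hg, mul_comm]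

end UnitRows

namespace MGraph

section MatrixTree

open Matrix

variable {V E : Type*}

theorem edgeCount_comm (G : MGraph V E) (A : Finset E) (x y : V) :
    G.edgeCount A x y = G.edgeCount A y x := by
  unfold edgeCount
  rw [Sym2.eq_swap]

theorem edgeCount_eq_zero_iff {G : MGraph V E} {A : Finset E} {x y : V} :
    G.edgeCount A x y = 0 ↔ ∀ e ∈ A, G.ends e ≠ s(x, y) := by
  simp [edgeCount, Finset.filter_eq_empty_iff]

theorem edgeCount_eq_add [DecidableEq V] [DecidableEq E] {G : MGraph V E} {A : Finset E} {e : E}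
    (he : e ∈ A) {s y : V} (hends : G.ends e = s(s, y)) (hsy : s ≠ y) (a b : V) :
    (G.edgeCount A a b : ℝ) = G.edgeCount (A.erase e) a b +
      ((Pi.single s 1 : V → ℝ) a * (Pi.single y 1 : V → ℝ) b +
        (Pi.single y 1 : V → ℝ) a * (Pi.single s 1 : V → ℝ) b) := by
  classical
  have hcount : G.edgeCount A a b =
      G.edgeCount (A.erase e) a b + if G.ends e = s(a, b) then 1 else 0 := by
    simp only [edgeCount, Finset.card_filter]
    convert (Finset.sum_erase_add A _ he).symm
  have hite : (if s(s, y) = s(a, b) then 1 else 0 : ℝ) =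
      (Pi.single s 1 : V → ℝ) a * (Pi.single y 1 : V → ℝ) b +
        (Pi.single y 1 : V → ℝ) a * (Pi.single s 1 : V → ℝ) b := by
    simp only [Pi.single_apply, Sym2.eq_iff]
    grind
  rw [hcount, hends, Nat.cast_add, Nat.cast_ite, Nat.cast_one, Nat.cast_zero, hite]

variable [Fintype V] [DecidableEq V]

/-- The Laplace matrix of the graph with edge set `A`. -/
noncomputable def laplacian (G : MGraph V E) (A : Finset E) : Matrix V V ℝ :=
  Matrix.diagonal (fun x => ∑ w, (G.edgeCount A x w : ℝ)) -
    Matrix.of fun x y => (G.edgeCount A x y : ℝ)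

/-- The Laplace matrix of the graph with edge set `A`, with the rows in `S` replaced by those of
the unit matrix. Solving a linear system with this matrix is a Dirichlet problem with boundary
`S`. -/
noncomputable def rootedLaplacian (G : MGraph V E) (A : Finset E) (S : Finset V) : Matrix V V ℝ :=
  unitRows (G.laplacian A) S

theorem laplacian_mulVec (G : MGraph V E) (A : Finset E) (h : V → ℝ) (x : V) :
    (G.laplacian A *ᵥ h) x = ∑ w, (G.edgeCount A x w : ℝ) * (h x - h w) := by
  rw [laplacian, Matrix.sub_mulVec, Pi.sub_apply, Matrix.mulVec_diagonal, Finset.sum_mul]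
  simp only [Matrix.mulVec, dotProduct, Matrix.of_apply, mul_sub, Finset.sum_sub_distrib]

theorem laplacian_transpose (G : MGraph V E) (A : Finset E) :
    (G.laplacian A)ᵀ = G.laplacian A := by
  rw [laplacian, Matrix.transpose_sub, Matrix.diagonal_transpose]
  congr 1
  ext x y
  exact congrArg Nat.cast (G.edgeCount_comm A y x)

theorem laplacian_eq_add [DecidableEq E] {G : MGraph V E} {A : Finset E} {e : E} (he : e ∈ A)
    {s y : V} (hends : G.ends e = s(s, y)) (hsy : s ≠ y) :
    G.laplacian A = G.laplacian (A.erase e) +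
      vecMulVec (Pi.single s 1 - Pi.single y 1) (Pi.single s 1 - Pi.single y 1) := by
  ext a b
  simp only [laplacian, Matrix.sub_apply, Matrix.add_apply, Matrix.of_apply, vecMulVec_apply,
    Matrix.diagonal_apply, edgeCount_eq_add he hends hsy, Finset.sum_add_distrib,
    ← Finset.mul_sum, Finset.sum_pi_single', Finset.mem_univ, if_true, Pi.sub_apply]
  rcases eq_or_ne a b with rfl | hab
  · simp only [if_true, Pi.single_apply]
    grind
  · simp only [if_neg hab, Pi.single_apply]
    grind

theorem rootedLaplacian_mulVec_of_mem (G : MGraph V E) (A : Finset E) {S : Finset V} {x : V}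
    (hx : x ∈ S) (h : V → ℝ) : (G.rootedLaplacian A S *ᵥ h) x = h x := by
  rw [rootedLaplacian, Matrix.mulVec, unitRows_of_mem _ hx, single_one_dotProduct]

theorem rootedLaplacian_mulVec_of_notMem (G : MGraph V E) (A : Finset E) {S : Finset V} {x : V}
    (hx : x ∉ S) (h : V → ℝ) :
    (G.rootedLaplacian A S *ᵥ h) x = ∑ w, (G.edgeCount A x w : ℝ) * (h x - h w) := by
  rw [← laplacian_mulVec, rootedLaplacian, Matrix.mulVec, unitRows_of_notMem _ hx]
  rfl

theorem rootedLaplacian_eq_updateRow [DecidableEq E] {G : MGraph V E} {A : Finset E}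
    {S : Finset V} {e : E} (he : e ∈ A) {s y : V} (hends : G.ends e = s(s, y)) (hs : s ∈ S)
    (hy : y ∉ S) :
    G.rootedLaplacian A S = (G.rootedLaplacian (A.erase e) S).updateRow y
      (G.rootedLaplacian (A.erase e) S y + (Pi.single y 1 + (-1 : ℝ) • Pi.single s 1)) := by
  have hsy : s ≠ y := ne_of_mem_of_not_mem hs hy
  funext x
  rcases eq_or_ne x y with rfl | hxy
  · rw [Matrix.updateRow_self, rootedLaplacian, rootedLaplacian, unitRows_of_notMem _ hy,
      unitRows_of_notMem _ hy, laplacian_eq_add he hends hsy]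
    ext w
    simp only [Matrix.add_apply, vecMulVec_apply, Pi.sub_apply, Pi.add_apply, Pi.smul_apply,
      Pi.single_eq_same, Pi.single_eq_of_ne hsy.symm, smul_eq_mul]
    ring
  · rw [Matrix.updateRow_ne hxy]
    by_cases hx : x ∈ S
    · rw [rootedLaplacian, rootedLaplacian, unitRows_of_mem _ hx, unitRows_of_mem _ hx]
    · rw [rootedLaplacian, rootedLaplacian, unitRows_of_notMem _ hx, unitRows_of_notMem _ hx,
        laplacian_eq_add he hends hsy]
      ext w
      simp [vecMulVec_apply, hxy, (ne_of_mem_of_not_mem hs hx).symm]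

theorem det_rootedLaplacian_eq_add [DecidableEq E] {G : MGraph V E} {A : Finset E}
    {S : Finset V} {e : E} (he : e ∈ A) {s y : V} (hends : G.ends e = s(s, y)) (hs : s ∈ S)
    (hy : y ∉ S) :
    (G.rootedLaplacian A S).det = (G.rootedLaplacian (A.erase e) S).det +
      (G.rootedLaplacian (A.erase e) (insert y S)).det := by
  have hsy : s ≠ y := ne_of_mem_of_not_mem hs hy
  have hdup : ((G.rootedLaplacian (A.erase e) S).updateRow y (Pi.single s 1)).det = 0 := by
    refine Matrix.det_zero_of_row_eq hsy ?_
    rw [Matrix.updateRow_self, Matrix.updateRow_ne hsy, rootedLaplacian, unitRows_of_mem _ hs]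
  rw [rootedLaplacian_eq_updateRow he hends hs hy, Matrix.det_updateRow_add,
    Matrix.updateRow_eq_self, Matrix.det_updateRow_add, Matrix.det_updateRow_smul, hdup,
    mul_zero, add_zero, rootedLaplacian, rootedLaplacian, unitRows_insert]

theorem det_rootedLaplacian_eq_zero {G : MGraph V E} {A : Finset E} {S : Finset V} {z : V}
    (hz : z ∉ S) (hA : ∀ e ∈ A, ∀ s ∈ S, ∀ y ∉ S, G.ends e ≠ s(s, y)) :
    (G.rootedLaplacian A S).det = 0 := by
  -- The indicator function of the complement of `S` lies in the kernel.
  refine Matrix.exists_mulVec_eq_zero_iff.1 ⟨fun x => if x ∈ S then 0 else 1, fun h => ?_, ?_⟩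
  · simpa [hz] using congrFun h z
  · ext x
    by_cases hx : x ∈ S
    · rw [rootedLaplacian_mulVec_of_mem G A hx, if_pos hx, Pi.zero_apply]
    · rw [rootedLaplacian_mulVec_of_notMem G A hx]
      refine Finset.sum_eq_zero fun w _ => ?_
      by_cases hw : w ∈ S
      · rw [edgeCount_comm, edgeCount_eq_zero_iff.2 fun e he => hA e he w hw x hx,
          Nat.cast_zero, zero_mul]
      · rw [if_neg hx, if_neg hw, sub_self, mul_zero]

/-- The matrix-tree theorem for rooted forests, by deletion and contraction of an edge that leaves
the set of roots. -/
theorem det_rootedLaplacian (G : MGraph V E) (A : Finset E) (S : Finset V) :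
    (G.rootedLaplacian A S).det = G.forestCount A S := by
  classical
  induction A using Finset.strongInduction generalizing S with
  | H A ih =>
    by_cases hS : ∃ z, z ∉ S
    · obtain ⟨z, hz⟩ := hS
      by_cases hA : ∀ e ∈ A, ∀ s ∈ S, ∀ y ∉ S, G.ends e ≠ s(s, y)
      · rw [det_rootedLaplacian_eq_zero hz hA, forestCount_eq_zero hz hA, Nat.cast_zero]
      · push Not at hA
        obtain ⟨e, he, s, hs, y, hy, hends⟩ := hA
        rw [det_rootedLaplacian_eq_add he hends hs hy, forestCount_eq_add he hends hs hy,
          ih _ (Finset.erase_ssubset he), ih _ (Finset.erase_ssubset he), Nat.cast_add]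
    · obtain rfl : S = Finset.univ := Finset.eq_univ_iff_forall.2 (not_exists_not.1 hS)
      rw [rootedLaplacian, unitRows_univ, Matrix.det_one, forestCount_univ, Nat.cast_one]

end MatrixTree

end MGraph

namespace MGraph

section Hitting

variable {V E : Type*} [Fintype E]

theorem stepProb_eq (G : MGraph V E) (x y : V) :
    G.stepProb x y = (G.edgeCount Finset.univ x y : ℝ) / G.degree x := rfl

theorem stepProb_nonneg (G : MGraph V E) (x y : V) : 0 ≤ G.stepProb x y := by
  rw [stepProb_eq]
  positivity

theorem pathProb_nonneg (G : MGraph V E) {k : ℕ} (γ : Fin (k + 1) → V) : 0 ≤ G.pathProb γ :=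
  Finset.prod_nonneg fun _ _ => G.stepProb_nonneg _ _

theorem pathProb_cons (G : MGraph V E) {k : ℕ} (a : V) (γ : Fin (k + 1) → V) :
    G.pathProb (Fin.cons a γ : Fin (k + 2) → V) = G.stepProb a (γ 0) * G.pathProb γ := by
  rw [pathProb, Fin.prod_univ_succ]
  rfl

/-- The path `γ` is in `{y, z}` for the first time at its last step, and is then at `y`. -/
def IsFirstHit {k : ℕ} (y z : V) (γ : Fin (k + 1) → V) : Prop :=
  γ (Fin.last k) = y ∧ ∀ i : Fin k, γ i.castSucc ≠ y ∧ γ i.castSucc ≠ z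

theorem isFirstHit_cons {k : ℕ} {x y z : V} {γ : Fin (k + 1) → V} :
    IsFirstHit y z (Fin.cons x γ : Fin (k + 2) → V) ↔ (x ≠ y ∧ x ≠ z) ∧ IsFirstHit y z γ := by
  rw [IsFirstHit, IsFirstHit, Fin.forall_fin_succ, and_left_comm]
  rfl

variable [Fintype V]

theorem sum_edgeCount (G : MGraph V E) (x : V) :
    ∑ w, G.edgeCount Finset.univ x w = G.degree x := by
  classical
  simp only [edgeCount, degree, Finset.card_filter]
  rw [Finset.sum_comm]
  refine Finset.sum_congr rfl fun e _ => ?_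
  by_cases hx : x ∈ G.ends e
  · obtain ⟨w, hw⟩ := Sym2.mem_iff_exists.1 hx
    rw [if_pos hx, hw]
    simp only [Sym2.congr_right]
    simp
  · rw [if_neg hx]
    refine Finset.sum_eq_zero fun w _ => if_neg fun h => hx ?_
    rw [h]
    exact Sym2.mem_mk_left x w

theorem sum_stepProb_le_one (G : MGraph V E) (x : V) : ∑ w, G.stepProb x w ≤ 1 := by
  simp only [stepProb_eq]
  rw [← Finset.sum_div, ← Nat.cast_sum, sum_edgeCount]
  exact div_self_le_one _

open Classical in
/-- The probability that the walk from `x` is in `{y, z}` for the first time at time `k`, and is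
then at `y`. -/
noncomputable def firstHitProb (G : MGraph V E) (y z : V) (k : ℕ) (x : V) : ℝ :=
  ∑ γ : Fin (k + 1) → V with (γ 0 = x ∧ IsFirstHit y z γ), G.pathProb γ

theorem hitBeforeProb_eq_tsum (G : MGraph V E) (x y z : V) :
    G.hitBeforeProb x y z = ∑' k, G.firstHitProb y z k x := by
  unfold hitBeforeProb firstHitProb IsFirstHit
  congr!

theorem firstHitProb_nonneg (G : MGraph V E) (y z : V) (k : ℕ) (x : V) :
    0 ≤ G.firstHitProb y z k x :=
  Finset.sum_nonneg fun γ _ => G.pathProb_nonneg γ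

theorem firstHitProb_zero (G : MGraph V E) [DecidableEq V] (y z x : V) :
    G.firstHitProb y z 0 x = if x = y then 1 else 0 := by
  classical
  rw [firstHitProb, Finset.sum_filter, ← (Equiv.funUnique (Fin 1) V).symm.sum_comp]
  simp [pathProb, IsFirstHit, ite_and]

theorem firstHitProb_succ_eq_zero (G : MGraph V E) {x y z : V} (hx : x = y ∨ x = z) (k : ℕ) :
    G.firstHitProb y z (k + 1) x = 0 := by
  classical
  rw [firstHitProb, Finset.filter_eq_empty_iff.2, Finset.sum_empty]
  rintro γ - ⟨rfl, -, hγ⟩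
  exact hx.elim (hγ 0).1 (hγ 0).2

theorem firstHitProb_succ (G : MGraph V E) {x y z : V} (hy : x ≠ y) (hz : x ≠ z) (k : ℕ) :
    G.firstHitProb y z (k + 1) x = ∑ w, G.stepProb x w * G.firstHitProb y z k w := by
  classical
  calc G.firstHitProb y z (k + 1) x
      = ∑ a, ∑ γ : Fin (k + 1) → V, if a = x ∧ IsFirstHit y z (Fin.cons a γ : Fin (k + 2) → V)
          then G.pathProb (Fin.cons a γ : Fin (k + 2) → V) else 0 := by
        rw [firstHitProb, Finset.sum_filter, ← (Fin.consEquiv fun _ => V).sum_comp,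
          Fintype.sum_prod_type]
        rfl
    _ = ∑ γ : Fin (k + 1) → V,
          if IsFirstHit y z γ then G.stepProb x (γ 0) * G.pathProb γ else 0 := by
        rw [Finset.sum_comm]
        simp [ite_and, isFirstHit_cons, pathProb_cons, hy, hz]
    _ = ∑ γ : Fin (k + 1) → V, ∑ w, if γ 0 = w ∧ IsFirstHit y z γ
          then G.stepProb x w * G.pathProb γ else 0 := by
        simp [ite_and]
    _ = ∑ w, G.stepProb x w * G.firstHitProb y z k w := by
        rw [Finset.sum_comm]
        simp only [firstHitProb, Finset.mul_sum, Finset.sum_filter, mul_ite, mul_zero]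

theorem sum_firstHitProb_le_one (G : MGraph V E) (y z : V) (K : ℕ) (x : V) :
    ∑ k ∈ Finset.range K, G.firstHitProb y z k x ≤ 1 := by
  classical
  induction K generalizing x with
  | zero => simp
  | succ K ih =>
    rw [Finset.sum_range_succ', firstHitProb_zero]
    by_cases h : x = y ∨ x = z
    · simp only [G.firstHitProb_succ_eq_zero h, Finset.sum_const_zero, zero_add]
      split_ifs <;> norm_num
    · obtain ⟨hy, hz⟩ := not_or.1 h
      simp only [G.firstHitProb_succ hy hz]
      rw [if_neg hy, add_zero, Finset.sum_comm]
      simp only [← Finset.mul_sum]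
      calc ∑ w, G.stepProb x w * ∑ k ∈ Finset.range K, G.firstHitProb y z k w
          ≤ ∑ w, G.stepProb x w := Finset.sum_le_sum fun w _ =>
            mul_le_of_le_one_right (G.stepProb_nonneg x w) (ih w)
        _ ≤ 1 := G.sum_stepProb_le_one x

theorem summable_firstHitProb (G : MGraph V E) (y z x : V) :
    Summable fun k => G.firstHitProb y z k x :=
  summable_of_sum_range_le (fun k => G.firstHitProb_nonneg y z k x)
    fun K => G.sum_firstHitProb_le_one y z K x

theorem hitBeforeProb_self (G : MGraph V E) (y z : V) : G.hitBeforeProb y y z = 1 := by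
  classical
  rw [hitBeforeProb_eq_tsum, (G.summable_firstHitProb y z y).tsum_eq_zero_add]
  simp [firstHitProb_succ_eq_zero, firstHitProb_zero]

theorem hitBeforeProb_right (G : MGraph V E) {y z : V} (h : y ≠ z) :
    G.hitBeforeProb z y z = 0 := by
  classical
  rw [hitBeforeProb_eq_tsum, (G.summable_firstHitProb y z z).tsum_eq_zero_add]
  simp [firstHitProb_succ_eq_zero, firstHitProb_zero, h.symm]

theorem hitBeforeProb_eq_sum (G : MGraph V E) {x y z : V} (hy : x ≠ y) (hz : x ≠ z) :
    G.hitBeforeProb x y z = ∑ w, G.stepProb x w * G.hitBeforeProb w y z := by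
  classical
  rw [hitBeforeProb_eq_tsum, (G.summable_firstHitProb y z x).tsum_eq_zero_add]
  simp only [G.firstHitProb_succ hy hz, firstHitProb_zero, if_neg hy, zero_add]
  rw [Summable.tsum_finsetSum fun w _ => (G.summable_firstHitProb y z w).mul_left _]
  simp only [tsum_mul_left, hitBeforeProb_eq_tsum]

theorem sum_edgeCount_mul_hitBeforeProb_sub (G : MGraph V E) {x y z : V} (hy : x ≠ y)
    (hz : x ≠ z) :
    ∑ w, (G.edgeCount Finset.univ x w : ℝ) *
      (G.hitBeforeProb x y z - G.hitBeforeProb w y z) = 0 := by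
  simp only [mul_sub, Finset.sum_sub_distrib]
  rw [← Finset.sum_mul, ← Nat.cast_sum, sum_edgeCount, sub_eq_zero, G.hitBeforeProb_eq_sum hy hz,
    Finset.mul_sum]
  refine Finset.sum_congr rfl fun w _ => ?_
  rw [stepProb_eq, ← mul_assoc, mul_div_cancel_of_imp']
  intro hdeg
  have hsum := G.sum_edgeCount x
  rw [Nat.cast_eq_zero.1 hdeg, Finset.sum_eq_zero_iff] at hsum
  rw [hsum w (Finset.mem_univ w), Nat.cast_zero]

end Hitting

section Green

open Matrix

variable {V E : Type*} [Fintype V] [Fintype E] [DecidableEq V]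

/-- The Green function of the walk killed at `z`, relative to the counting measure. (The column of
`z` consists of ones, not of zeros.) -/
noncomputable def green (G : MGraph V E) (z : V) : Matrix V V ℝ :=
  (G.rootedLaplacian Finset.univ {z})⁻¹

/-- The effective resistance between distinct vertices `y` and `z` when every edge has unit
resistance, by Kirchhoff's formula. (For `y = z` the formula gives `1`, not `0`.) -/
noncomputable def effResistance (G : MGraph V E) (y z : V) : ℝ :=
  G.forestCount Finset.univ {y, z} / G.spanningTrees.card

/-- For `a ≠ b`, the expected number of edges that join `a` and `b` in a uniform spanning tree,
by Kirchhoff's formula. -/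
noncomputable def expectedEdgeCount (G : MGraph V E) (a b : V) : ℝ :=
  G.edgeCount Finset.univ a b * G.effResistance a b

theorem effResistance_comm (G : MGraph V E) (y z : V) :
    G.effResistance y z = G.effResistance z y := by
  rw [effResistance, effResistance, Finset.pair_comm]

theorem expectedEdgeCount_nonneg (G : MGraph V E) (a b : V) : 0 ≤ G.expectedEdgeCount a b := by
  rw [expectedEdgeCount, effResistance]
  positivity

theorem det_rootedLaplacian_singleton (G : MGraph V E) (z : V) :
    (G.rootedLaplacian Finset.univ {z}).det = G.spanningTrees.card := by
  rw [det_rootedLaplacian, forestCount_singleton]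

theorem green_self (G : MGraph V E) (y z : V) : G.green z y y = G.effResistance y z := by
  rw [green, Matrix.inv_def, Matrix.smul_apply, Matrix.adjugate_apply, rootedLaplacian,
    ← unitRows_insert, ← rootedLaplacian, ← rootedLaplacian, det_rootedLaplacian_singleton,
    det_rootedLaplacian, Ring.inverse_eq_inv', smul_eq_mul, effResistance, div_eq_inv_mul]

variable {G : MGraph V E}

theorem Connected.card_spanningTrees_pos {V : Type*} [Finite V] {G : MGraph V E}
    (hG : G.Connected) : 0 < G.spanningTrees.card := by
  classical
  have := Fintype.ofFinite V
  obtain ⟨v⟩ : Nonempty V := hG.nonempty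
  rw [← forestCount_singleton v]
  exact hG.forestCount_pos (Finset.singleton_nonempty v)

theorem Connected.effResistance_pos (hG : G.Connected) (y z : V) : 0 < G.effResistance y z :=
  div_pos (Nat.cast_pos.2 (hG.forestCount_pos (Finset.insert_nonempty y {z})))
    (Nat.cast_pos.2 hG.card_spanningTrees_pos)

theorem Connected.isUnit_det_rootedLaplacian (hG : G.Connected) (z : V) :
    IsUnit (G.rootedLaplacian Finset.univ {z}).det := by
  rw [det_rootedLaplacian_singleton, isUnit_iff_ne_zero, Nat.cast_ne_zero]
  exact hG.card_spanningTrees_pos.ne'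

theorem Connected.forestCount_insert_image (hG : G.Connected) (z : V) {σ : Type*} [Fintype σ]
    [DecidableEq σ] {g : σ → V} (hg : Function.Injective g) :
    (G.forestCount Finset.univ (insert z (Finset.univ.image g)) : ℝ) =
      G.spanningTrees.card * ((G.green z).submatrix g g).det := by
  rw [← det_rootedLaplacian, ← det_rootedLaplacian_singleton G z, green,
    ← det_unitRows_image (hG.isUnit_det_rootedLaplacian z) hg, rootedLaplacian, rootedLaplacian,
    unitRows_unitRows, Finset.insert_eq]

theorem Connected.green_mulVec_rootedLaplacian_mulVec (hG : G.Connected) (z : V) (h : V → ℝ) :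
    G.green z *ᵥ (G.rootedLaplacian Finset.univ {z} *ᵥ h) = h := by
  rw [Matrix.mulVec_mulVec, green, Matrix.nonsing_inv_mul _ (hG.isUnit_det_rootedLaplacian z),
    Matrix.one_mulVec]

theorem Connected.rootedLaplacian_mulVec_green (hG : G.Connected) (z y : V) :
    G.rootedLaplacian Finset.univ {z} *ᵥ (G.green z).col y = Pi.single y 1 := by
  rw [← Matrix.mulVec_single_one, Matrix.mulVec_mulVec, green,
    Matrix.mul_nonsing_inv _ (hG.isUnit_det_rootedLaplacian z), Matrix.one_mulVec]

theorem Connected.green_root_left (hG : G.Connected) {y z : V} (hy : y ≠ z) :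
    G.green z z y = 0 := by
  have h := congrFun (hG.rootedLaplacian_mulVec_green z y) z
  rwa [G.rootedLaplacian_mulVec_of_mem _ (Finset.mem_singleton_self z),
    Pi.single_eq_of_ne hy.symm] at h

theorem Connected.laplacian_mulVec_green (hG : G.Connected) {w z : V} (hw : w ≠ z) (y : V) :
    (G.laplacian Finset.univ *ᵥ (G.green z).col y) w = (Pi.single y 1 : V → ℝ) w := by
  rw [← hG.rootedLaplacian_mulVec_green z y, laplacian_mulVec,
    G.rootedLaplacian_mulVec_of_notMem _ (Finset.notMem_singleton.2 hw)]

theorem Connected.green_dotProduct_laplacian_mulVec_green (hG : G.Connected) {x z : V}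
    (hx : x ≠ z) (y : V) (hy : y ≠ z) :
    (G.green z).col x ⬝ᵥ (G.laplacian Finset.univ *ᵥ (G.green z).col y) = G.green z y x := by
  rw [← Matrix.col_apply (G.green z) x y, ← dotProduct_single_one ((G.green z).col x) y]
  refine Finset.sum_congr rfl fun w _ => ?_
  rcases eq_or_ne w z with rfl | hw
  · rw [Matrix.col_apply, hG.green_root_left hx, zero_mul, zero_mul]
  · rw [hG.laplacian_mulVec_green hw]

theorem Connected.green_comm (hG : G.Connected) {x y z : V} (hx : x ≠ z) (hy : y ≠ z) :
    G.green z x y = G.green z y x := by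
  rw [← hG.green_dotProduct_laplacian_mulVec_green hy x hx,
    ← hG.green_dotProduct_laplacian_mulVec_green hx y hy, Matrix.dotProduct_mulVec,
    ← Matrix.mulVec_transpose, laplacian_transpose, dotProduct_comm]

theorem rootedLaplacian_mulVec_hitBeforeProb (G : MGraph V E) {y z : V} (hy : y ≠ z) :
    ∃ c, G.rootedLaplacian Finset.univ {z} *ᵥ (G.hitBeforeProb · y z) = Pi.single y c := by
  refine ⟨(G.rootedLaplacian Finset.univ {z} *ᵥ (G.hitBeforeProb · y z)) y, funext fun x => ?_⟩
  rcases eq_or_ne x y with rfl | hxy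
  · rw [Pi.single_eq_same]
  rw [Pi.single_eq_of_ne hxy]
  rcases eq_or_ne x z with rfl | hxz
  · rw [G.rootedLaplacian_mulVec_of_mem _ (Finset.mem_singleton_self x), G.hitBeforeProb_right hy]
  · rw [G.rootedLaplacian_mulVec_of_notMem _ (Finset.notMem_singleton.2 hxz),
      G.sum_edgeCount_mul_hitBeforeProb_sub hxy hxz]

theorem Connected.hitBeforeProb_mul_effResistance (hG : G.Connected) (x : V) {y z : V}
    (hy : y ≠ z) : G.hitBeforeProb x y z * G.effResistance y z = G.green z x y := by
  obtain ⟨c, hc⟩ := G.rootedLaplacian_mulVec_hitBeforeProb hy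
  have hgreen (x : V) : G.hitBeforeProb x y z = G.green z x y * c := by
    have h := congrFun (hG.green_mulVec_rootedLaplacian_mulVec z (G.hitBeforeProb · y z)) x
    rw [hc, Matrix.mulVec_single] at h
    simpa using h.symm
  have hy' : G.green z y y * c = 1 := by rw [← hgreen, hitBeforeProb_self]
  rw [hgreen, ← G.green_self y z, mul_assoc, mul_comm c, hy', mul_one]

theorem Connected.hitBeforeProb_mul_effResistance_comm (hG : G.Connected) {x y z : V}
    (hx : x ≠ z) (hy : y ≠ z) :
    G.hitBeforeProb x y z * G.effResistance y z = G.hitBeforeProb y x z * G.effResistance x z := by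
  rw [hG.hitBeforeProb_mul_effResistance x hy, hG.hitBeforeProb_mul_effResistance y hx,
    hG.green_comm hx hy]

theorem Connected.sum_edgeCount_mul_green (hG : G.Connected) {a z : V} (hz : z ≠ a) :
    ∑ w ∈ Finset.univ.erase a, (G.edgeCount Finset.univ a w : ℝ) * G.green a z w = 1 := by
  have hmul : G.rootedLaplacian Finset.univ {a} *ᵥ (fun w => if w = a then 0 else 1) =
      fun w => if w = a then 0 else (G.edgeCount Finset.univ a w : ℝ) := by
    ext w
    by_cases hw : w = a
    · rw [G.rootedLaplacian_mulVec_of_mem _ (Finset.mem_singleton.2 hw), if_pos hw, if_pos hw]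
    · rw [G.rootedLaplacian_mulVec_of_notMem _ (Finset.notMem_singleton.2 hw), if_neg hw,
        if_neg hw, Finset.sum_eq_single a]
      · rw [if_pos rfl, sub_zero, mul_one, edgeCount_comm]
      · intro u _ hu
        rw [if_neg hu, sub_self, mul_zero]
      · exact fun ha => absurd (Finset.mem_univ a) ha
  have hone := congrFun (hG.green_mulVec_rootedLaplacian_mulVec a fun w => if w = a then 0 else 1) z
  rw [hmul, if_neg hz] at hone
  rw [← hone, Matrix.mulVec, dotProduct, ← Finset.add_sum_erase _ _ (Finset.mem_univ a),
    if_pos rfl, mul_zero, zero_add]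
  refine Finset.sum_congr rfl fun w hw => ?_
  rw [if_neg (Finset.ne_of_mem_erase hw), mul_comm]

theorem Connected.sum_expectedEdgeCount_mul_hitBeforeProb (hG : G.Connected) {a z : V}
    (hz : z ≠ a) :
    ∑ w ∈ Finset.univ.erase a, G.expectedEdgeCount a w * G.hitBeforeProb z w a = 1 := by
  rw [← hG.sum_edgeCount_mul_green hz]
  refine Finset.sum_congr rfl fun w hw => ?_
  rw [← hG.hitBeforeProb_mul_effResistance z (Finset.ne_of_mem_erase hw), expectedEdgeCount,
    G.effResistance_comm a w, mul_assoc, mul_comm (G.effResistance w a)]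

/-- The probabilities that the walk from `f a` hits `f b` before `f x`, for `a` and `b` different
from `x`. -/
noncomputable def hitMatrix (G : MGraph V E) {τ : Type*} (f : τ → V) (x : τ) :
    Matrix {b // b ≠ x} {b // b ≠ x} ℝ :=
  Matrix.of fun a b => G.hitBeforeProb (f a) (f b) (f x)

theorem Connected.forestCount_image (hG : G.Connected) {τ : Type*} [Fintype τ] [DecidableEq τ]
    {f : τ → V} (hf : Function.Injective f) (x : τ) :
    (G.forestCount Finset.univ (Finset.univ.image f) : ℝ) = G.spanningTrees.card *
      ((∏ b ∈ {x}ᶜ, G.effResistance (f b) (f x)) * (G.hitMatrix f x).det) := by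
  have himage : Finset.univ.image f =
      insert (f x) (Finset.univ.image (f ∘ Subtype.val (p := (· ≠ x)))) := by
    ext w
    simp only [Finset.mem_image, Finset.mem_insert, Finset.mem_univ, true_and, Subtype.exists,
      Function.comp_apply]
    grind
  have hgreen : (G.green (f x)).submatrix (f ∘ (↑)) (f ∘ (↑)) =
      Matrix.of fun a b : {b // b ≠ x} =>
        G.effResistance (f b) (f x) * G.hitMatrix f x a b := by
    ext a b
    exact (hG.hitBeforeProb_mul_effResistance _ (hf.ne b.2)).symm.trans (mul_comm _ _)
  rw [himage, hG.forestCount_insert_image (f x) (hf.comp Subtype.val_injective), hgreen,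
    Matrix.det_mul_row, Finset.prod_subtype (p := (· ≠ x)) _ (by simp)]

end Green

end MGraph

section InjExtensions

variable {τ V : Type*} [Fintype τ] [Fintype V]

open Classical in
/-- The injective maps that agree with `g` on `U`. -/
noncomputable def injExtensions (U : Finset τ) (g : τ → V) : Finset (τ → V) :=
  {f | Function.Injective f ∧ ∀ a ∈ U, f a = g a}

theorem mem_injExtensions {U : Finset τ} {f g : τ → V} :
    f ∈ injExtensions U g ↔ Function.Injective f ∧ ∀ a ∈ U, f a = g a := by
  simp [injExtensions]

theorem injExtensions_univ {g : τ → V} (hg : Function.Injective g) :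
    injExtensions Finset.univ g = {g} := by
  ext f
  simp only [mem_injExtensions, Finset.mem_univ, forall_const, ← funext_iff,
    Finset.mem_singleton, and_iff_right_iff_imp]
  exact fun h => h ▸ hg

variable [DecidableEq τ] [DecidableEq V] {U : Finset τ} {L : List (τ × τ)}

theorem sum_injExtensions {M : Type*} [AddCommMonoid M] (g : τ → V) {y : τ} (hy : y ∉ U)
    (F : (τ → V) → M) :
    ∑ f ∈ injExtensions U g, F f =
      ∑ w ∈ (U.image g)ᶜ, ∑ f ∈ injExtensions (insert y U) (Function.update g y w), F f := by
  rw [← Finset.sum_fiberwise_of_maps_to (t := (U.image g)ᶜ) (g := fun f => f y)]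
  · refine Finset.sum_congr rfl fun w _ => Finset.sum_congr ?_ fun _ _ => rfl
    ext f
    have hupdate : (∀ a ∈ U, f a = Function.update g y w a) ↔ ∀ a ∈ U, f a = g a :=
      forall₂_congr fun a ha => by rw [Function.update_of_ne (ne_of_mem_of_not_mem ha hy)]
    simp only [Finset.mem_filter, mem_injExtensions, Finset.forall_mem_insert,
      Function.update_self, hupdate]
    tauto
  · intro f hf
    obtain ⟨hinj, hfg⟩ := mem_injExtensions.1 hf
    simp only [Finset.mem_compl, Finset.mem_image, not_exists, not_and]
    intro a ha hay
    exact hy (hinj (hay ▸ hfg a ha) ▸ ha)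

theorem sum_injExtensions_prod_cons {R : Type*} [CommSemiring R] (ω : V → V → R) {p y : τ}
    (hp : p ∈ U) (hy : y ∉ U) (L : List (τ × τ)) (g : τ → V) :
    ∑ f ∈ injExtensions U g, (((p, y) :: L).map fun q => ω (f q.1) (f q.2)).prod =
      ∑ w ∈ (U.image g)ᶜ, ω (g p) w *
        ∑ f ∈ injExtensions (insert y U) (Function.update g y w),
          (L.map fun q => ω (f q.1) (f q.2)).prod := by
  rw [sum_injExtensions g hy]
  refine Finset.sum_congr rfl fun w _ => ?_
  rw [Finset.mul_sum]
  refine Finset.sum_congr rfl fun f hf => ?_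
  have hfg := (mem_injExtensions.1 hf).2
  rw [List.map_cons, List.prod_cons, hfg p (Finset.mem_insert_of_mem hp),
    hfg y (Finset.mem_insert_self y U), Function.update_self,
    Function.update_of_ne (ne_of_mem_of_not_mem hp hy)]

theorem Grows.sum_injExtensions_prod_mem_Icc {ω : V → V → ℝ} {c δ : ℝ} (hω : ∀ a b, 0 ≤ ω a b)
    (hδ : δ ≤ c) (hsum : ∀ S : Finset V, S.card ≤ Fintype.card τ → ∀ a ∈ S,
      |∑ w ∈ Sᶜ, ω a w - c| ≤ δ)
    (h : Grows U L) {g : τ → V} (hg : Set.InjOn g U) :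
    ∑ f ∈ injExtensions U g, (L.map fun q => ω (f q.1) (f q.2)).prod ∈
      Set.Icc ((c - δ) ^ L.length) ((c + δ) ^ L.length) := by
  induction h generalizing g with
  | nil => simp [injExtensions_univ (Set.injOn_univ.1 (by simpa using hg))]
  | @cons U p y L hp hy _ ih =>
    have hmem (w : V) (hw : w ∈ (U.image g)ᶜ) := by
      refine ih (g := Function.update g y w) ?_
      have heq : Set.EqOn (Function.update g y w) g U := fun a ha =>
        Function.update_of_ne (ne_of_mem_of_not_mem ha hy) w g
      rw [Finset.coe_insert, Set.injOn_insert hy, heq.injOn_iff, Function.update_self,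
        heq.image_eq]
      exact ⟨hg, by simpa using hw⟩
    obtain ⟨hlower, hupper⟩ := abs_sub_le_iff.1 <| hsum (U.image g)
      (Finset.card_image_le.trans (Finset.card_le_univ U)) (g p) (Finset.mem_image_of_mem g hp)
    have hcδ : 0 ≤ c + δ :=
      (Finset.sum_nonneg fun w _ => hω (g p) w).trans (sub_le_iff_le_add'.1 hlower)
    rw [sum_injExtensions_prod_cons ω hp hy, List.length_cons, pow_succ', pow_succ']
    constructor
    · calc (c - δ) * (c - δ) ^ L.length
          ≤ (∑ w ∈ (U.image g)ᶜ, ω (g p) w) * (c - δ) ^ L.length :=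
            mul_le_mul_of_nonneg_right (sub_le_comm.1 hupper) (pow_nonneg (sub_nonneg.2 hδ) _)
        _ ≤ _ := by
            rw [Finset.sum_mul]
            exact Finset.sum_le_sum fun w hw => mul_le_mul_of_nonneg_left (hmem w hw).1 (hω _ w)
    · calc _ ≤ (∑ w ∈ (U.image g)ᶜ, ω (g p) w) * (c + δ) ^ L.length := by
            rw [Finset.sum_mul]
            exact Finset.sum_le_sum fun w hw => mul_le_mul_of_nonneg_left (hmem w hw).2 (hω _ w)
        _ ≤ (c + δ) * (c + δ) ^ L.length :=
            mul_le_mul_of_nonneg_right (sub_le_iff_le_add'.1 hlower) (pow_nonneg hcδ _)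

end InjExtensions

open Classical in
theorem treeMapCount_eq_card {τ V : Type*} [Fintype τ] [Fintype V] (t : SimpleGraph τ) (x : τ)
    (W : SimpleGraph V) (v : V) :
    treeMapCount t x W v = ((injExtensions {x} fun _ => v).filter fun f =>
      ∀ a b, t.Adj a b → W.Adj (f a) (f b)).card := by
  rw [treeMapCount, Nat.card_eq_fintype_card, Fintype.card_subtype]
  congr 1
  ext f
  simp [mem_injExtensions, and_assoc]

namespace MGraph

section TreeMaps

variable {V E τ : Type*} [Fintype E]

theorem ustExpectation_eq_sum_div (G : MGraph V E) (X : Finset E → ℝ) :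
    G.ustExpectation X = (∑ T ∈ G.spanningTrees, X T) / G.spanningTrees.card := by
  classical
  simp only [ustExpectation, ustProb, ite_mul, zero_mul, Finset.sum_ite_mem, Finset.univ_inter,
    Finset.sum_div, one_div_mul_eq_div]

variable [Fintype V] [Fintype τ] {t : SimpleGraph τ} {L : List (τ × τ)}

open Classical in
theorem filter_spanningTrees_eq_forestsThrough (G : MGraph V E) {f : τ → V}
    (hf : Function.Injective f) (x : τ)
    (hadj : ∀ a b, t.Adj a b ↔ s(a, b) ∈ L.map fun q => s(q.1, q.2)) :
    (G.spanningTrees.filter fun T : Finset E => ∀ a b, t.Adj a b →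
      (G.nbrGraph (T : Set E)).Adj (f a) (f b)) =
      G.forestsThrough {f x} (L.map (Prod.map f f)) := by
  ext T
  rw [Finset.mem_filter, mem_forestsThrough, spanningTrees, Finset.mem_filter_univ,
    isSpanningTree_iff_isRootedForest (f x)]
  refine and_congr_right fun _ => ⟨fun h q hq => ?_, fun h a b hab => ?_⟩
  · obtain ⟨⟨a, b⟩, hab, rfl⟩ := List.mem_map.1 hq
    exact (nbrGraph_adj.1 (h a b ((hadj a b).2 (List.mem_map_of_mem hab)))).1
  · obtain ⟨q, hq, hqab⟩ := List.mem_map.1 ((hadj a b).1 hab)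
    obtain ⟨e, he, hends⟩ := h _ (List.mem_map_of_mem hq)
    refine nbrGraph_adj.2 ⟨⟨e, he, hends.trans ?_⟩, hf.ne hab.ne⟩
    exact congrArg (Sym2.map f) hqab

theorem ustExpectation_treeMapCount [DecidableEq V] [DecidableEq τ] (G : MGraph V E) (v : V)
    {x : τ} (hL : Grows {x} L) (hadj : ∀ a b, t.Adj a b ↔ s(a, b) ∈ L.map fun q => s(q.1, q.2)) :
    (G.ustExpectation fun T => (treeMapCount t x (G.nbrGraph (T : Set E)) v : ℝ)) =
      ∑ f ∈ injExtensions {x} fun _ => v,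
        (L.map fun q => (G.edgeCount Finset.univ (f q.1) (f q.2) : ℝ)).prod *
          G.forestCount Finset.univ (Finset.univ.image f) / G.spanningTrees.card := by
  classical
  rw [ustExpectation_eq_sum_div, ← Finset.sum_div]
  congr 1
  simp only [treeMapCount_eq_card, Finset.card_filter, Nat.cast_sum]
  rw [Finset.sum_comm]
  refine Finset.sum_congr rfl fun f hf => ?_
  obtain ⟨hinj, -⟩ := mem_injExtensions.1 hf
  rw [← Nat.cast_sum, ← Finset.card_filter, G.filter_spanningTrees_eq_forestsThrough hinj x hadj,
    ← Finset.image_singleton, card_forestsThrough_map hinj hL, Nat.cast_mul,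
    Nat.cast_list_prod, List.map_map]
  rfl

variable [DecidableEq V] [DecidableEq τ]

/-- The expected number of ways in which the edges of a uniform spanning tree realize the copy of
a tree given by an injective map `f`, divided by the product of the expected numbers of edges for
the edges of the copy. The list `L` explores the tree from its root `x`. -/
noncomputable def edgeCorrelation (G : MGraph V E) (f : τ → V) (x : τ) (L : List (τ × τ)) : ℝ :=
  (L.map fun q => G.effResistance (f q.2) (f x) / G.effResistance (f q.1) (f q.2)).prod *
    (G.hitMatrix f x).det

theorem Connected.ustExpectation_treeMapCount {G : MGraph V E}
    (hG : G.Connected) (v : V) {x : τ} (hL : Grows {x} L)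
    (hadj : ∀ a b, t.Adj a b ↔ s(a, b) ∈ L.map fun q => s(q.1, q.2)) :
    (G.ustExpectation fun T => (treeMapCount t x (G.nbrGraph (T : Set E)) v : ℝ)) =
      ∑ f ∈ injExtensions {x} fun _ => v,
        (L.map fun q => G.expectedEdgeCount (f q.1) (f q.2)).prod * G.edgeCorrelation f x L := by
  rw [MGraph.ustExpectation_treeMapCount G v hL hadj]
  refine Finset.sum_congr rfl fun f hf => ?_
  rw [edgeCorrelation, ← mul_assoc, ← List.prod_map_mul,
    hG.forestCount_image (mem_injExtensions.1 hf).1 x,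
    ← hL.prod_map_snd fun b => G.effResistance (f b) (f x), mul_left_comm,
    mul_div_cancel_left₀ _ (Nat.cast_ne_zero.2 hG.card_spanningTrees_pos.ne'), ← mul_assoc,
    ← List.prod_map_mul]
  congr 3
  funext q
  rw [expectedEdgeCount, mul_assoc, mul_div_cancel₀ _ (hG.effResistance_pos _ _).ne']

end TreeMaps

end MGraph

namespace MGraph

section HitBias

variable {V E : Type*} [Fintype V] [Fintype E]

/-- The largest deviation from `1 / 2` of the probability that the walk from a vertex hits a
second vertex before a third one. -/
noncomputable def hitBias (G : MGraph V E) : ℝ :=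
  ⨆ p : {p : V × V × V // p.1 ≠ p.2.1 ∧ p.1 ≠ p.2.2 ∧ p.2.1 ≠ p.2.2},
    |G.hitBeforeProb p.1.1 p.1.2.1 p.1.2.2 - 1 / 2|

theorem hitBias_nonneg (G : MGraph V E) : 0 ≤ G.hitBias :=
  Real.iSup_nonneg fun _ => abs_nonneg _

theorem abs_hitBeforeProb_sub_le_hitBias (G : MGraph V E) {x y z : V} (hxy : x ≠ y) (hxz : x ≠ z)
    (hyz : y ≠ z) : |G.hitBeforeProb x y z - 1 / 2| ≤ G.hitBias :=
  le_ciSup (f := fun p : {p : V × V × V // p.1 ≠ p.2.1 ∧ p.1 ≠ p.2.2 ∧ p.2.1 ≠ p.2.2} =>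
    |G.hitBeforeProb p.1.1 p.1.2.1 p.1.2.2 - 1 / 2|) (Set.finite_range _).bddAbove
    ⟨(x, y, z), hxy, hxz, hyz⟩

theorem hitBias_le {G : MGraph V E} {ε : ℝ} (hε : 0 ≤ ε)
    (h : ∀ x y z : V, x ≠ y → x ≠ z → y ≠ z → |G.hitBeforeProb x y z - 1 / 2| ≤ ε) :
    G.hitBias ≤ ε :=
  Real.iSup_le (fun p => h _ _ _ p.2.1 p.2.2.1 p.2.2.2) hε

variable [DecidableEq V] {G : MGraph V E}

theorem Connected.abs_expectedEdgeCount_add_sum_sub_two_le (hG : G.Connected) {a z : V}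
    (hz : z ≠ a) :
    |G.expectedEdgeCount a z + ∑ w ∈ Finset.univ.erase a, G.expectedEdgeCount a w - 2| ≤
      2 * G.hitBias * ∑ w ∈ Finset.univ.erase a, G.expectedEdgeCount a w := by
  have hmem : z ∈ Finset.univ.erase a := Finset.mem_erase.2 ⟨hz, Finset.mem_univ z⟩
  have hsum := hG.sum_expectedEdgeCount_mul_hitBeforeProb hz
  rw [← Finset.add_sum_erase _ _ hmem, hitBeforeProb_self, mul_one] at hsum
  have hdev : |∑ w ∈ (Finset.univ.erase a).erase z,
      G.expectedEdgeCount a w * (G.hitBeforeProb z w a - 1 / 2)| ≤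
      G.hitBias * ∑ w ∈ Finset.univ.erase a, G.expectedEdgeCount a w :=
    calc _ ≤ ∑ w ∈ (Finset.univ.erase a).erase z, G.expectedEdgeCount a w * G.hitBias := by
          refine (Finset.abs_sum_le_sum_abs _ _).trans (Finset.sum_le_sum fun w hw => ?_)
          obtain ⟨hwz, hwa, -⟩ : w ≠ z ∧ w ≠ a ∧ w ∈ Finset.univ := by simpa using hw
          rw [abs_mul, abs_of_nonneg (G.expectedEdgeCount_nonneg a w)]
          exact mul_le_mul_of_nonneg_left (G.abs_hitBeforeProb_sub_le_hitBias hwz.symm hz hwa)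
            (G.expectedEdgeCount_nonneg a w)
      _ ≤ ∑ w ∈ Finset.univ.erase a, G.expectedEdgeCount a w * G.hitBias :=
          Finset.sum_le_sum_of_subset_of_nonneg (Finset.erase_subset z _) fun w _ _ =>
            mul_nonneg (G.expectedEdgeCount_nonneg a w) G.hitBias_nonneg
      _ = _ := by rw [← Finset.sum_mul, mul_comm]
  simp only [mul_sub, Finset.sum_sub_distrib, ← Finset.sum_mul] at hdev
  rw [eq_sub_of_add_eq' hsum] at hdev
  rw [← Finset.add_sum_erase _ _ hmem] at hdev ⊢
  rw [abs_le] at hdev ⊢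
  constructor <;> linarith

theorem Connected.sum_erase_expectedEdgeCount_le (hG : G.Connected) (hb : G.hitBias ≤ 1 / 4)
    (a : V) : ∑ w ∈ Finset.univ.erase a, G.expectedEdgeCount a w ≤ 4 := by
  rcases (Finset.univ.erase a).eq_empty_or_nonempty with h | ⟨z, hz⟩
  · rw [h, Finset.sum_empty]
    norm_num
  · have hsum := (abs_le.1 (hG.abs_expectedEdgeCount_add_sum_sub_two_le
      (Finset.ne_of_mem_erase hz))).2
    have hle := mul_le_mul_of_nonneg_right hb
      (Finset.sum_nonneg fun w (_ : w ∈ Finset.univ.erase a) => G.expectedEdgeCount_nonneg a w)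
    linarith [G.expectedEdgeCount_nonneg a z]

theorem Connected.abs_expectedEdgeCount_add_sum_sub_two_le_hitBias (hG : G.Connected)
    (hb : G.hitBias ≤ 1 / 4) {a z : V} (hz : z ≠ a) :
    |G.expectedEdgeCount a z + ∑ w ∈ Finset.univ.erase a, G.expectedEdgeCount a w - 2| ≤
      8 * G.hitBias := by
  have hle := mul_le_mul_of_nonneg_left (hG.sum_erase_expectedEdgeCount_le hb a) G.hitBias_nonneg
  linarith [hG.abs_expectedEdgeCount_add_sum_sub_two_le hz]

theorem Connected.abs_sum_erase_expectedEdgeCount_sub_two_le (hG : G.Connected)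
    (hb : G.hitBias ≤ 1 / 4) (a : V) :
    |∑ w ∈ Finset.univ.erase a, G.expectedEdgeCount a w - 2| ≤
      8 * G.hitBias + 2 / Fintype.card V := by
  set Ω := ∑ w ∈ Finset.univ.erase a, G.expectedEdgeCount a w with hΩ
  have hN : 0 < (Fintype.card V : ℝ) := Nat.cast_pos.2 (Fintype.card_pos_iff.2 ⟨a⟩)
  have hcard : ((Finset.univ.erase a).card : ℝ) = Fintype.card V - 1 := by
    rw [Finset.cast_card_erase_of_mem (Finset.mem_univ a), Finset.card_univ]
  have hsum : |Fintype.card V * Ω - 2 * (Fintype.card V - 1)| ≤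
      (Fintype.card V - 1) * (8 * G.hitBias) :=
    calc _ = |∑ z ∈ Finset.univ.erase a, (G.expectedEdgeCount a z + Ω - 2)| := by
          rw [Finset.sum_sub_distrib, Finset.sum_add_distrib, Finset.sum_const, Finset.sum_const,
            nsmul_eq_mul, nsmul_eq_mul, hcard, ← hΩ]
          ring_nf
      _ ≤ ∑ z ∈ Finset.univ.erase a, 8 * G.hitBias :=
          (Finset.abs_sum_le_sum_abs _ _).trans <| Finset.sum_le_sum fun z hz =>
            hG.abs_expectedEdgeCount_add_sum_sub_two_le_hitBias hb (Finset.ne_of_mem_erase hz)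
      _ = _ := by rw [Finset.sum_const, nsmul_eq_mul, hcard]
  refine le_of_mul_le_mul_left ?_ hN
  rw [← abs_of_pos hN, ← abs_mul, abs_of_pos hN, mul_add, mul_div_cancel₀ _ hN.ne']
  rw [abs_le] at hsum ⊢
  constructor <;> linarith [G.hitBias_nonneg]

theorem Connected.expectedEdgeCount_le (hG : G.Connected) (hb : G.hitBias ≤ 1 / 4) {a z : V}
    (hz : z ≠ a) : G.expectedEdgeCount a z ≤ 16 * G.hitBias + 2 / Fintype.card V := by
  linarith [(abs_le.1 (hG.abs_expectedEdgeCount_add_sum_sub_two_le_hitBias hb hz)).2,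
    (abs_le.1 (hG.abs_sum_erase_expectedEdgeCount_sub_two_le hb a)).1]

theorem Connected.abs_sum_compl_expectedEdgeCount_sub_two_le (hG : G.Connected)
    (hb : G.hitBias ≤ 1 / 4) {S : Finset V} {a : V} (ha : a ∈ S) :
    |∑ w ∈ Sᶜ, G.expectedEdgeCount a w - 2| ≤
      S.card * (16 * G.hitBias + 2 / Fintype.card V) := by
  have hsplit : ∑ w ∈ Sᶜ, G.expectedEdgeCount a w + ∑ w ∈ S.erase a, G.expectedEdgeCount a w =
      ∑ w ∈ Finset.univ.erase a, G.expectedEdgeCount a w := by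
    rw [Finset.sum_erase_eq_sub ha, Finset.sum_erase_eq_sub (Finset.mem_univ a), ← add_sub_assoc,
      Finset.sum_compl_add_sum]
  have hle : ∑ w ∈ S.erase a, G.expectedEdgeCount a w ≤
      (S.card - 1) * (16 * G.hitBias + 2 / Fintype.card V) := by
    rw [← Finset.cast_card_erase_of_mem ha, ← nsmul_eq_mul, ← Finset.sum_const]
    exact Finset.sum_le_sum fun w hw => hG.expectedEdgeCount_le hb (Finset.ne_of_mem_erase hw)
  have hnonneg := Finset.sum_nonneg fun w (_ : w ∈ S.erase a) => G.expectedEdgeCount_nonneg a w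
  have herase := abs_le.1 (hG.abs_sum_erase_expectedEdgeCount_sub_two_le hb a)
  rw [← hsplit] at herase
  rw [abs_le]
  constructor <;> linarith [G.hitBias_nonneg]

end HitBias

end MGraph

theorem tendsto_sum_mul_of_tendsto_sigma {ι : Type*} {l : Filter ι} {β : ι → Type*}
    {s : ∀ i, Finset (β i)} {w F : ∀ i, β i → ℝ} {c d : ℝ} (hw : ∀ i, ∀ b ∈ s i, 0 ≤ w i b)
    (hc : Tendsto (fun i => ∑ b ∈ s i, w i b) l (𝓝 c))
    (hF : Tendsto (fun q : Σ i, s i => F q.1 q.2) (comap Sigma.fst l) (𝓝 d)) :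
    Tendsto (fun i => ∑ b ∈ s i, w i b * F i b) l (𝓝 (c * d)) := by
  have hdev : Tendsto (fun i => ∑ b ∈ s i, w i b * (F i b - d)) l (𝓝 0) := by
    rw [Metric.tendsto_nhds]
    intro ε hε
    have hM : 0 < |c| + 1 := by positivity
    have hclose := eventually_comap.1 (Metric.tendsto_nhds.1 hF _ (div_pos hε hM))
    filter_upwards [hclose, hc.eventually_lt_const ((le_abs_self c).trans_lt (lt_add_one _))]
      with i hi hci
    rw [Real.dist_0_eq_abs]
    calc |∑ b ∈ s i, w i b * (F i b - d)| ≤ ∑ b ∈ s i, w i b * (ε / (|c| + 1)) := by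
          refine (Finset.abs_sum_le_sum_abs _ _).trans (Finset.sum_le_sum fun b hb => ?_)
          rw [abs_mul, abs_of_nonneg (hw i b hb)]
          exact mul_le_mul_of_nonneg_left (hi ⟨i, b, hb⟩ rfl).le (hw i b hb)
      _ = (∑ b ∈ s i, w i b) * (ε / (|c| + 1)) := (Finset.sum_mul _ _ _).symm
      _ < (|c| + 1) * (ε / (|c| + 1)) := mul_lt_mul_of_pos_right hci (div_pos hε hM)
      _ = ε := mul_div_cancel₀ _ hM.ne'
  simpa [mul_sub, ← Finset.sum_mul] using hdev.add (hc.mul_const d)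

theorem det_one_add_const {n R : Type*} [Fintype n] [DecidableEq n] [CommRing R] (r : R) :
    (1 + Matrix.of fun _ _ : n => r).det = 1 + Fintype.card n * r := by
  have hrank : (Matrix.of fun _ _ : n => r) =
      Matrix.replicateCol Unit (fun _ : n => r) * Matrix.replicateRow Unit (1 : n → R) := by
    ext a b
    simp [Matrix.mul_apply]
  rw [hrank, Matrix.det_one_add_replicateCol_mul_replicateRow, one_dotProduct, Finset.sum_const,
    Finset.card_univ, nsmul_eq_mul]

theorem det_ite_eq_one_half {n : Type*} [Fintype n] [DecidableEq n] :
    (Matrix.of fun a b : n => if a = b then (1 : ℝ) else 1 / 2).det =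
      (Fintype.card n + 1) / 2 ^ Fintype.card n := by
  have hM : (Matrix.of fun a b : n => if a = b then (1 : ℝ) else 1 / 2) =
      (1 / 2 : ℝ) • (1 + Matrix.of fun _ _ => 1) := by
    ext a b
    rcases eq_or_ne a b with rfl | hab
    · norm_num [Matrix.of_apply]
    · simp [hab]
  rw [hM, Matrix.det_smul, det_one_add_const, mul_one, div_pow, one_pow, add_comm,
    one_div_mul_eq_div]

theorem Grows.fst_ne_snd {τ : Type*} [Fintype τ] [DecidableEq τ] {U : Finset τ}
    {L : List (τ × τ)} (h : Grows U L) : ∀ q ∈ L, q.1 ≠ q.2 := by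
  induction h with
  | nil => simp
  | cons hp hy _ ih => exact List.forall_mem_cons.2 ⟨ne_of_mem_of_not_mem hp hy, ih⟩

namespace MGraph

section Asymptotics

variable {ι : Type*} {l : Filter ι} {V E : ι → Type*} [∀ i, Fintype (V i)] [∀ i, Fintype (E i)]
  {G : ∀ i, MGraph (V i) (E i)}

theorem tendsto_hitBias (h : ∀ ε > 0, ∀ᶠ i in l, ∀ x y z : V i, x ≠ y → x ≠ z → y ≠ z →
    |(G i).hitBeforeProb x y z - 1 / 2| ≤ ε) : Tendsto (fun i => (G i).hitBias) l (𝓝 0) := by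
  refine tendsto_order.2 ⟨fun r hr => .of_forall fun i => hr.trans_le (G i).hitBias_nonneg,
    fun r hr => ?_⟩
  filter_upwards [h (r / 2) (half_pos hr)] with i hi
  exact (hitBias_le (half_pos hr).le hi).trans_lt (half_lt_self hr)

theorem tendsto_hitBeforeProb (hbias : Tendsto (fun i => (G i).hitBias) l (𝓝 0))
    {x y z : ∀ i, V i} (hxy : ∀ i, x i ≠ y i) (hxz : ∀ i, x i ≠ z i) (hyz : ∀ i, y i ≠ z i) :
    Tendsto (fun i => (G i).hitBeforeProb (x i) (y i) (z i)) l (𝓝 (1 / 2)) := by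
  rw [tendsto_iff_dist_tendsto_zero]
  exact squeeze_zero (fun _ => dist_nonneg)
    (fun i => (G i).abs_hitBeforeProb_sub_le_hitBias (hxy i) (hxz i) (hyz i)) hbias

variable {τ : Type*} [Fintype τ] [DecidableEq τ]

theorem tendsto_det_hitMatrix (hbias : Tendsto (fun i => (G i).hitBias) l (𝓝 0))
    {f : ∀ i, τ → V i} (hf : ∀ i, Function.Injective (f i)) (x : τ) :
    Tendsto (fun i => ((G i).hitMatrix (f i) x).det) l
      (𝓝 ((Fintype.card {b // b ≠ x} + 1) / 2 ^ Fintype.card {b // b ≠ x})) := by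
  rw [← det_ite_eq_one_half]
  refine (Continuous.matrix_det continuous_id).continuousAt.tendsto.comp ?_
  refine tendsto_pi_nhds.2 fun a => tendsto_pi_nhds.2 fun b => ?_
  rcases eq_or_ne a b with rfl | hab
  · simp only [Matrix.of_apply, hitBeforeProb_self, if_true]
    exact tendsto_const_nhds
  · simp only [Matrix.of_apply, if_neg hab]
    exact tendsto_hitBeforeProb hbias (fun i => (hf i).ne (Subtype.coe_ne_coe.2 hab))
      (fun i => (hf i).ne a.2) (fun i => (hf i).ne b.2)

variable [∀ i, DecidableEq (V i)]

theorem tendsto_effResistance_div (hconn : ∀ i, (G i).Connected)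
    (hbias : Tendsto (fun i => (G i).hitBias) l (𝓝 0)) {x y z : ∀ i, V i}
    (hxy : ∀ i, x i ≠ y i) (hxz : ∀ i, x i ≠ z i) (hyz : ∀ i, y i ≠ z i) :
    Tendsto (fun i => (G i).effResistance (x i) (z i) / (G i).effResistance (y i) (z i)) l
      (𝓝 1) := by
  have hx := tendsto_hitBeforeProb hbias hxy hxz hyz
  have hy := tendsto_hitBeforeProb hbias (fun i => (hxy i).symm) hyz hxz
  have hhalf : (1 / 2 : ℝ) ≠ 0 := one_half_pos.ne'
  have hdiv := hx.div hy hhalf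
  rw [div_self hhalf] at hdiv
  refine hdiv.congr' ?_
  filter_upwards [hy.eventually_ne hhalf] with i hi
  rw [Pi.div_apply, div_eq_div_iff hi ((hconn i).effResistance_pos _ _).ne',
    (hconn i).hitBeforeProb_mul_effResistance_comm (hxz i) (hyz i), mul_comm]

theorem tendsto_edgeCorrelation (hconn : ∀ i, (G i).Connected)
    (hbias : Tendsto (fun i => (G i).hitBias) l (𝓝 0)) {f : ∀ i, τ → V i}
    (hf : ∀ i, Function.Injective (f i)) {x : τ} {L : List (τ × τ)} (hL : Grows {x} L) :
    Tendsto (fun i => (G i).edgeCorrelation (f i) x L) l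
      (𝓝 (Fintype.card τ / 2 ^ L.length)) := by
  have hlength : L.length + 1 = Fintype.card τ := hL.length_add_card
  have hcard : Fintype.card {b // b ≠ x} = L.length := by
    rw [Fintype.card_subtype, Finset.filter_ne', Finset.card_erase_of_mem (Finset.mem_univ x),
      Finset.card_univ, ← hlength, Nat.add_sub_cancel]
  have hratio : ∀ q ∈ L, Tendsto (fun i => (G i).effResistance (f i q.2) (f i x) /
      (G i).effResistance (f i q.1) (f i q.2)) l (𝓝 1) := by
    intro q hq
    have hqx : q.2 ≠ x := Finset.notMem_singleton.1 (hL.snd_notMem q hq)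
    simp only [fun i => (G i).effResistance_comm (f i q.2) (f i x)]
    rcases eq_or_ne q.1 x with h | h
    · simp only [h, fun i => div_self ((hconn i).effResistance_pos (f i x) (f i q.2)).ne']
      exact tendsto_const_nhds
    · exact tendsto_effResistance_div hconn hbias (fun i => (hf i).ne h.symm)
        (fun i => (hf i).ne hqx.symm) (fun i => (hf i).ne (hL.fst_ne_snd q hq))
  have hprod := (tendsto_list_prod L hratio).mul (tendsto_det_hitMatrix hbias hf x)
  simpa [edgeCorrelation, hcard, ← hlength] using hprod

theorem tendsto_edgeCorrelation_sigma (hconn : ∀ i, (G i).Connected)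
    (hbias : Tendsto (fun i => (G i).hitBias) l (𝓝 0)) (v : ∀ i, V i) {x : τ} {L : List (τ × τ)}
    (hL : Grows {x} L) :
    Tendsto (fun q : Σ i, {f : τ → V i // f ∈ injExtensions {x} fun _ => v i} =>
      (G q.1).edgeCorrelation q.2 x L) (comap Sigma.fst l)
      (𝓝 (Fintype.card τ / 2 ^ L.length)) := by
  have hinj (q : Σ i, {f : τ → V i // f ∈ injExtensions {x} fun _ => v i}) :
      Function.Injective (q.2 : τ → V q.1) := (mem_injExtensions.1 q.2.2).1
  have hbias' := hbias.comp (tendsto_comap (f := fun q : Σ i,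
    {f : τ → V i // f ∈ injExtensions {x} fun _ => v i} => q.1))
  exact tendsto_edgeCorrelation (G := fun q : Σ i, _ => G q.1) (fun q => hconn q.1) hbias' hinj hL

theorem tendsto_sum_prod_expectedEdgeCount (hconn : ∀ i, (G i).Connected)
    (hcard : Tendsto (fun i => Fintype.card (V i)) l atTop)
    (hbias : Tendsto (fun i => (G i).hitBias) l (𝓝 0)) (v : ∀ i, V i) {x : τ}
    {L : List (τ × τ)} (hL : Grows {x} L) :
    Tendsto (fun i => ∑ f ∈ injExtensions {x} fun _ => v i,
      (L.map fun q => (G i).expectedEdgeCount (f q.1) (f q.2)).prod) l (𝓝 (2 ^ L.length)) := by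
  set δ : ι → ℝ := fun i =>
    Fintype.card τ * (16 * (G i).hitBias + 2 / Fintype.card (V i))
  have hδ0 : Tendsto δ l (𝓝 0) := by
    have hinv : Tendsto (fun i => 2 / (Fintype.card (V i) : ℝ)) l (𝓝 0) :=
      (tendsto_natCast_atTop_atTop.comp hcard).const_div_atTop 2
    simpa using ((hbias.const_mul 16).add hinv).const_mul (Fintype.card τ : ℝ)
  have hmem : ∀ᶠ i in l, ∑ f ∈ injExtensions {x} fun _ => v i,
      (L.map fun q => (G i).expectedEdgeCount (f q.1) (f q.2)).prod ∈
        Set.Icc ((2 - δ i) ^ L.length) ((2 + δ i) ^ L.length) := by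
    filter_upwards [hδ0.eventually_le_const (show (0 : ℝ) < 2 by norm_num),
      hbias.eventually_le_const (show (0 : ℝ) < 1 / 4 by norm_num)] with i hi hb
    refine hL.sum_injExtensions_prod_mem_Icc (G i).expectedEdgeCount_nonneg hi ?_
      (by simp)
    intro S hS a ha
    refine ((hconn i).abs_sum_compl_expectedEdgeCount_sub_two_le hb ha).trans ?_
    have hnonneg := (G i).hitBias_nonneg
    exact mul_le_mul_of_nonneg_right (Nat.cast_le.2 hS) (by positivity)
  have hlower : Tendsto (fun i => (2 - δ i) ^ L.length) l (𝓝 (2 ^ L.length)) := by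
    simpa using (hδ0.const_sub 2).pow L.length
  have hupper : Tendsto (fun i => (2 + δ i) ^ L.length) l (𝓝 (2 ^ L.length)) := by
    simpa using (hδ0.const_add 2).pow L.length
  exact tendsto_of_tendsto_of_tendsto_of_le_of_le' hlower hupper (hmem.mono fun _ h => h.1)
    (hmem.mono fun _ h => h.2)

end Asymptotics

end MGraph

theorem mainTheorem6_general {ι : Type*} {l : Filter ι} {V E : ι → Type*} [∀ i, Fintype (V i)]
    [∀ i, Fintype (E i)] (G : ∀ i, MGraph (V i) (E i)) (hconn : ∀ i, (G i).Connected)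
    (hcard : Tendsto (fun i => Fintype.card (V i)) l atTop)
    (hhit : ∀ ε > 0, ∀ᶠ i in l, ∀ x y z : V i, x ≠ y → x ≠ z → y ≠ z →
      |(G i).hitBeforeProb x y z - 1 / 2| ≤ ε)
    (v : ∀ i, V i) {τ : Type*} [Fintype τ] (t : SimpleGraph τ) (ht : t.IsTree) (x : τ) :
    Tendsto
      (fun i => (G i).ustExpectation fun T =>
        (treeMapCount t x ((G i).nbrGraph (T : Set (E i))) (v i) : ℝ))
      l (𝓝 (Fintype.card τ : ℝ)) := by
  classical
  obtain ⟨L, hL, hadj⟩ := exists_grows_of_isTree ht x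
  have hbias := MGraph.tendsto_hitBias hhit
  have hweight := MGraph.tendsto_sum_prod_expectedEdgeCount hconn hcard hbias v hL
  have hcorr := MGraph.tendsto_edgeCorrelation_sigma hconn hbias v hL
  have hnonneg (i : ι) (f : τ → V i) :
      0 ≤ (L.map fun q => (G i).expectedEdgeCount (f q.1) (f q.2)).prod := by
    refine List.prod_nonneg fun r hr => ?_
    obtain ⟨q, -, rfl⟩ := List.mem_map.1 hr
    exact (G i).expectedEdgeCount_nonneg _ _
  have hsum := tendsto_sum_mul_of_tendsto_sigma
    (F := fun i f => (G i).edgeCorrelation f x L) (fun i f _ => hnonneg i f) hweight hcorr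
  rw [mul_div_cancel₀ _ (pow_ne_zero _ two_ne_zero)] at hsum
  exact hsum.congr fun i => ((hconn i).ustExpectation_treeMapCount (v i) hL hadj).symm

theorem mainTheorem6 {V E : ℕ → Type*} [∀ n, Fintype (V n)] [∀ n, Fintype (E n)]
    (G : ∀ n, MGraph (V n) (E n)) (hconn : ∀ n, (G n).Connected)
    (hG : MGraph.GinoRegular G) (v : ∀ n, V n)
    {τ : Type*} [Fintype τ] (t : SimpleGraph τ) (ht : t.IsTree) (x : τ) :
    Tendsto
      (fun n => (G n).ustExpectation fun T =>
        (treeMapCount t x ((G n).nbrGraph (T : Set (E n))) (v n) : ℝ))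
      atTop (𝓝 (Fintype.card τ : ℝ)) := by
  obtain ⟨hcard, -, -, hhit⟩ := hG
  exact mainTheorem6_general G hconn hcard hhit v t ht x
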